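/- **Setting.** An extended IFS $(X,D)$ consists of a non-empty Hausdorff space $X$ and a finite set $D$ of continuous maps $d\colon X^{\mathrm{ar}(d)}\to X$ of positive arity. It is a *digit space* if $X$ is a compact metric space with metric $\rho$, the sets $\mathrm{range}(d)$, $d\in D$, cover $X$, and each $d$ is a contraction with respect to the maximum metric on $X^{\mathrm{ar}(d)}$. It is *well-covering* if every $x\in X$ lies in the interior of $\mathrm{range}(d)$ for some $d\in D$. Let $Q=\{u_0,u_1,\dots\}$ be a countable dense subset of $X$ (its elements are called basic; computations on $Q$ are computations on indices), and similarly $Q'$ for a metric space $(X',\rho')$. A map $h\colon X^m\to X'$ is *computable* if there is a computable $\zeta\colon\mathbb Q_+\to\mathbb Q_+$ such that $\rho(\vec x,\vec y)<\zeta(\varepsilon)$ implies $\rho'(h(\vec x),h(\vec y))<\varepsilon$, and there is an algorithm that, given $\vec u\in Q^m$ and $n\in\mathbb N$, outputs some $v\in Q'$ with $\rho'(h(\vec u),v)<2^{-n}$. A digit space with such a $Q$, $(X,D,Q)$, is a *computable digit space* if $\{(u,v,r)\in Q^2\times\mathbb Q : \rho(u,v)<r\}$ and $\{(u,v,r)\in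 Q^2\times\mathbb Q:\rho(u,v)>r\}$ are recursively enumerable and every $d\in D$ is computable. It is *decidable* if for $u\in Q$, $\theta\in\mathbb Q_+$, $d\in D$ it is decidable whether the open ball $B(u,\theta)$ is contained in $\mathrm{range}(d)$. It has *approximable choice* if for every $d\in D$ there is an effective procedure $(\theta,u)\mapsto v^\theta_u\in Q^{\mathrm{ar}(d)}$, defined for $\theta\in\mathbb Q_+$ and $u\in Q\cap\mathrm{int}(\mathrm{range}(d))$, such that for all such $\theta$: (1) $\rho(v^\theta_u,v^{\tilde\theta}_u)<\max\{\theta,\tilde\theta\}$ for all $u$ and $\tilde\theta\in\mathbb Q_+$; (2) one can compute from $\theta$ some $\theta'\in\mathbb Q_+$ such that $\rho(u,u')<\theta'$ implies $\rho(v^\theta_u,v^\theta_{u'})<\theta$ for all $u,u'$; (3) for all $u$ there is $\vec y\in d^{-1}[\{u\}]$ with $\rho(\vec y,v^\theta_u)<\theta$ (here $u,u'$ range over $Q\cap\mathrm{int}(\mathrm{range}(d))$). **The class.** Let $(X,D)$, $(Y,E)$ be extended IFS and $\mathbb F(X,Y)$ the set of all maps $f\colon X^m\to Y$, $m\ge 0$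 (write $\mathrm{ar}(f)=m$). For $d\in D$ and $1\le i\le m$ let $d^{(i,m)}\colon X^{\mathrm{ar}(d)+m-1}\to X^m$ apply $d$ to the $\mathrm{ar}(d)$ arguments starting at position $i$ and leave the other arguments unchanged. For $F\subseteq\mathbb F(X,Y)$ let $\mathcal J(F)$ be the least $G\subseteq\mathbb F(X,Y)$ such that * (W) if $e\in E$ and $f_1,\dots,f_{\mathrm{ar}(e)}\in F$ have the same arity, then $\vec x\mapsto e(f_1(\vec x),\dots,f_{\mathrm{ar}(e)}(\vec x))$ is in $G$; * (R) if $h\in\mathbb F(X,Y)$, $1\le i\le\mathrm{ar}(h)$ and $h\circ d^{(i,\mathrm{ar}(h))}\in G$ for all $d\in D$, then $h\in G$. Let $\mathbb C_{\mathbb F(X,Y)}$ be the greatest fixed point of $\mathcal J$. Membership in it is understood constructively, that is, through realisers: infinite trees whose nodes are either *writing nodes*, labelled with some $e\in E$ and having $\mathrm{ar}(e)$ immediate subtrees, or *reading nodes*, labelled with a letter $R_i$ and having one immediate subtree for each $d\in D$. The relation "$T$ realises $f\in\mathbb C_{\mathbb F(X,Y)}$" is defined by the same nested fixed points: it is $\nu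 \mathcal F.\,\mu\mathcal G.\,\tilde\Phi(\mathcal F)(\mathcal G)$, where $(T,f)\in\tilde\Phi(\mathcal F)(\mathcal G)$ iff either the root of $T$ is a writing node with label $e$ and $f=e(f_1(\cdot),\dots,f_{\mathrm{ar}(e)}(\cdot))$ for some $f_\kappa$ of arity $\mathrm{ar}(f)$ with $(T_\kappa,f_\kappa)\in\mathcal F$ for every immediate subtree $T_\kappa$, or the root is a reading node with label $R_i$, $1\le i\le\mathrm{ar}(f)$, and $(T_d,f\circ d^{(i,\mathrm{ar}(f))})\in\mathcal G$ for all $d\in D$. **Theorem.** Let $(X,D,Q_X)$ and $(Y,E,Q_Y)$ be decidable and well-covering computable digit spaces with approximable choice. Then $\mathbb C_{\mathbb F(X,Y)}$, understood constructively, is the class of computable maps in $\mathbb F(X,Y)$. Explicitly: a map $f\in\mathbb F(X,Y)$ belongs to the set $\mathbb C_{\mathbb F(X,Y)}$ if and only if some tree realises $f\in\mathbb C_{\mathbb F(X,Y)}$, and $$\{f\in\mathbb F(X,Y) : \text{some computable tree realises } f\in\mathbb C_{\mathbb F(X,Y)}\}=\{f\in\mathbb F(X,Y) : f \text{ is computable}\}.$$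 -/

import Mathlib

namespace DigitSpaces

/-! ### Extended iterated function systems and digit spaces -/

/-- The maps of an extended iterated function system on `X`: a finite family of continuous maps
`digit d : X ^ (ar d) → X` of positive arity. -/
structure ExtendedIFS (X : Type*) [TopologicalSpace X] where
  /-- The number of digits. -/
  size : ℕ
  /-- The arity of a digit. -/
  ar : Fin size → ℕ
  ar_pos : ∀ d, 0 < ar d
  /-- The map belonging to a digit. -/
  digit : (d : Fin size) → (Fin (ar d) → X) → X
  continuous_digit : ∀ d, Continuous (digit d)

section Spaces

variable {X : Type*} [MetricSpace X]

/-- `(X, D)` is a digit space: `X` is a non-empty compact metric space, the ranges of the digits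
cover `X`, and every digit is a contraction with respect to the maximum metric on powers of `X`
(which is the metric Mathlib puts on `Fin n → X`). -/
structure IsDigitSpace (D : ExtendedIFS X) : Prop where
  nonempty : Nonempty X
  compact : CompactSpace X
  covering : ∀ x : X, ∃ d, x ∈ Set.range (D.digit d)
  contracting : ∀ d, ∃ K : NNReal, K < 1 ∧ LipschitzWith K (D.digit d)

/-- Every point lies in the interior of the range of some digit. -/
def IsWellCovering (D : ExtendedIFS X) : Prop :=
  ∀ x : X, ∃ d, x ∈ interior (Set.range (D.digit d))

end Spaces

/-! ### Computability

A countable dense subset with its coding is given by a sequence `Q : ℕ → X` with dense range;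
procedures on basic elements work on indices. -/

/-- The positive rational coded by a pair of natural numbers. -/
noncomputable def posRat (c : ℕ × ℕ) : ℝ := ((c.1 : ℝ) + 1) / ((c.2 : ℝ) + 1)

/-- The rational number coded by a triple of natural numbers. -/
noncomputable def ratOf (c : ℕ × ℕ × ℕ) : ℝ := ((c.1 : ℝ) - (c.2.1 : ℝ)) / ((c.2.2 : ℝ) + 1)

section Computability

variable {X : Type*} [MetricSpace X] {Y : Type*} [MetricSpace Y]

/-- `(X, Q)` is a computable metric space. -/
structure IsComputableMetric (Q : ℕ → X) : Prop where
  dense : DenseRange Q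
  lt_re : REPred fun p : ℕ × ℕ × (ℕ × ℕ × ℕ) => dist (Q p.1) (Q p.2.1) < ratOf p.2.2
  gt_re : REPred fun p : ℕ × ℕ × (ℕ × ℕ × ℕ) => ratOf p.2.2 < dist (Q p.1) (Q p.2.1)

/-- A map `h : X ^ m → Y` is computable: it has a computable modulus of uniform continuity, and
there is a procedure that, given `u ∈ Q ^ m` and `n`, computes a basic element of `Y` at distance
less than `2⁻ⁿ` from `h u`. -/
def IsComputableMap (Q : ℕ → X) (Q' : ℕ → Y) {m : ℕ} (h : (Fin m → X) → Y) : Prop :=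
  (∃ ζ : ℕ × ℕ → ℕ × ℕ, Computable ζ ∧
    ∀ (ε : ℕ × ℕ) (x y : Fin m → X), dist x y < posRat (ζ ε) → dist (h x) (h y) < posRat ε) ∧
  ∃ G : (Fin m → ℕ) × ℕ → ℕ, Computable G ∧
    ∀ (u : Fin m → ℕ) (n : ℕ), dist (h fun k => Q (u k)) (Q' (G (u, n))) < (1 / 2 : ℝ) ^ n

/-- `(X, D, Q)` is a computable digit space. -/
structure IsComputableDigitSpace (D : ExtendedIFS X) (Q : ℕ → X) : Prop where
  digitSpace : IsDigitSpace D
  computableMetric : IsComputableMetric Q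
  computable_digit : ∀ d, IsComputableMap Q Q (D.digit d)

/-- For basic `u`, positive rational `θ` and a digit `d` it can be decided whether the open ball
`B(u, θ)` is contained in the range of `d`. -/
def IsDecidable (D : ExtendedIFS X) (Q : ℕ → X) : Prop :=
  ComputablePred fun p : ℕ × (ℕ × ℕ) × Fin D.size =>
    Metric.ball (Q p.1) (posRat p.2.1) ⊆ Set.range (D.digit p.2.2)

/-- Approximable choice. For each digit `d` there is a function `v` assigning to `θ` and to
`u ∈ int (range d) ∩ Q` an element of `Q ^ (ar d)`; the procedure `p` computing it has to terminate
on these arguments only. The computable function `t` yields the `θ'` of the second condition. -/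
def HasApproximableChoice (D : ExtendedIFS X) (Q : ℕ → X) : Prop :=
  ∀ d : Fin D.size,
    ∃ (v : ℕ × ℕ → ℕ → Fin (D.ar d) → ℕ) (p : (ℕ × ℕ) × ℕ →. (Fin (D.ar d) → ℕ))
      (t : ℕ × ℕ → ℕ × ℕ),
      Partrec p ∧ Computable t ∧
      (∀ θ u, Q u ∈ interior (Set.range (D.digit d)) → v θ u ∈ p (θ, u)) ∧
      ∀ θ : ℕ × ℕ,
        (∀ u, Q u ∈ interior (Set.range (D.digit d)) → ∀ θ₁ : ℕ × ℕ,
          dist (fun k => Q (v θ u k)) (fun k => Q (v θ₁ u k)) < max (posRat θ) (posRat θ₁)) ∧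
        (∀ u u', Q u ∈ interior (Set.range (D.digit d)) →
          Q u' ∈ interior (Set.range (D.digit d)) → dist (Q u) (Q u') < posRat (t θ) →
          dist (fun k => Q (v θ u k)) (fun k => Q (v θ u' k)) < posRat θ) ∧
        (∀ u, Q u ∈ interior (Set.range (D.digit d)) →
          ∃ y : Fin (D.ar d) → X, D.digit d y = Q u ∧ dist y (fun k => Q (v θ u k)) < posRat θ)

end Computability

/-! ### The inductive/co-inductive class -/

/-- All maps `X ^ m → Y`, for `m ≥ 0`. -/
abbrev Maps (X Y : Type*) := Σ m : ℕ, (Fin m → X) → Y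

/-- `plug d i` is the map `d^(i, m) : X ^ (n + m - 1) → X ^ m`,
`(x₁, …, xᵢ₋₁, y₁, …, yₙ, xᵢ₊₁, …, xₘ) ↦ (x₁, …, xᵢ₋₁, d (y₁, …, yₙ), xᵢ₊₁, …, xₘ)`
(here with indices starting at `0`). -/
def plug {X : Type*} {n m : ℕ} (d : (Fin n → X) → X) (i : Fin m) (x : Fin (n + m - 1) → X) :
    Fin m → X := fun j =>
  if h₁ : (j : ℕ) < i then x ⟨j, by omega⟩
  else if h₂ : (j : ℕ) = i then d fun k => x ⟨i + k, by omega⟩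
  else x ⟨j + n - 1, by omega⟩

section Class

variable {X : Type*} [TopologicalSpace X] {Y : Type*} [TopologicalSpace Y]

/-- The operator `Φ(F)(G)`: the first alternative is the write rule
`f = e ∘ (f₁ × ⋯ × f_{ar e})`, where `(f₁ × ⋯ × fᵣ)(x) = (f₁ x, …, fᵣ x)`, and the second one
is the read rule. -/
def Phi (D : ExtendedIFS X) (E : ExtendedIFS Y) (F G : Set (Maps X Y)) : Set (Maps X Y) :=
  {f | (∃ (e : Fin E.size) (g : Fin (E.ar e) → (Fin f.1 → X) → Y),
          (∀ k, (⟨f.1, g k⟩ : Maps X Y) ∈ F) ∧ f.2 = fun x => E.digit e fun k => g k x) ∨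
       ∃ i : Fin f.1, ∀ d : Fin D.size,
          (⟨D.ar d + f.1 - 1, f.2 ∘ plug (D.digit d) i⟩ : Maps X Y) ∈ G}

theorem Phi_mono (D : ExtendedIFS X) (E : ExtendedIFS Y) {F F' G G' : Set (Maps X Y)}
    (hF : F ⊆ F') (hG : G ⊆ G') : Phi D E F G ⊆ Phi D E F' G' := by
  rintro f (⟨e, g, h, hf⟩ | ⟨i, h⟩)
  · exact Or.inl ⟨e, g, fun k => hF (h k), hf⟩
  · exact Or.inr ⟨i, fun d => hG (h d)⟩

/-- `J(F) = μ G. Φ(F)(G)`, as a monotone operator in `F`. -/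
def J (D : ExtendedIFS X) (E : ExtendedIFS Y) : Set (Maps X Y) →o Set (Maps X Y) where
  toFun F := OrderHom.lfp ⟨Phi D E F, fun _ _ h => Phi_mono D E subset_rfl h⟩
  monotone' _ _ h := OrderHom.lfp.monotone fun _ => Phi_mono D E h subset_rfl

/-- The class `ℂ_{𝔽(X, Y)} = ν F. μ G. Φ(F)(G)`. -/
def CF (D : ExtendedIFS X) (E : ExtendedIFS Y) : Set (Maps X Y) := OrderHom.gfp (J D E)

end Class

/-! ### Infinite labelled trees -/

/-- Infinite trees with nodes labelled by elements of `A`, where a node with label `a` has exactly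
`ar a` immediate successors (numbered from `0`). A tree is the partial labelling of the words over
`ℕ`; its set of nodes is the domain of the labelling. -/
structure LTree (A : Type*) (ar : A → ℕ) where
  label : List ℕ → Option A
  root_isSome : (label []).isSome
  compatible : ∀ (s : List ℕ) (i : ℕ),
    (label (s ++ [i])).isSome ↔ ∃ a, label s = some a ∧ i < ar a

namespace LTree

variable {A : Type*} {ar : A → ℕ}

/-- The label of the root. -/
def root (T : LTree A ar) : A := (T.label []).get T.root_isSome

/-- The `i`-th immediate subtree. -/
def subtree (T : LTree A ar) (i : ℕ) (hi : i < ar T.root) : LTree A ar where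
  label s := T.label (i :: s)
  root_isSome := (T.compatible [] i).2 ⟨T.root, (Option.some_get T.root_isSome).symm, hi⟩
  compatible s j := T.compatible (i :: s) j

/-- A tree is computable if its labelling is. -/
def IsComputable [Primcodable A] (T : LTree A ar) : Prop := Computable T.label

end LTree

/-! ### Realisers of membership in the class -/

section Realisers

variable {X : Type*} [TopologicalSpace X] {Y : Type*} [TopologicalSpace Y]

/-- Labels of realisers: a digit `e` of `Y` (writing node) or a letter `R_i` (reading node). -/
abbrev Label (E : ExtendedIFS Y) := Fin E.size ⊕ ℕ

/-- A writing node labelled `e` has `ar e` successors, a reading node has one for each digit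
of `X`. -/
def labelAr (D : ExtendedIFS X) (E : ExtendedIFS Y) : Label E → ℕ :=
  Sum.elim E.ar fun _ => D.size

/-- The trees that can be realisers. -/
abbrev FTree (D : ExtendedIFS X) (E : ExtendedIFS Y) := LTree (Label E) (labelAr D E)

/-- The realisability version of `Φ(F)(G)`: the tree shows which alternative holds, together with
the digit `e` and the realisers of the `f_k`, respectively the index `i` and the realisers for the
maps `f ∘ d^(i, m)`. -/
def RPhi (D : ExtendedIFS X) (E : ExtendedIFS Y) (F G : Set (FTree D E × Maps X Y)) :
    Set (FTree D E × Maps X Y) :=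
  {p | (∃ (e : Fin E.size) (he : p.1.root = Sum.inl e)
          (g : Fin (E.ar e) → (Fin p.2.1 → X) → Y),
          (∀ k : Fin (E.ar e),
            (p.1.subtree k (by rw [he]; exact k.2), (⟨p.2.1, g k⟩ : Maps X Y)) ∈ F) ∧
          p.2.2 = fun x => E.digit e fun k => g k x) ∨
       ∃ (i : Fin p.2.1) (hi : p.1.root = Sum.inr (i : ℕ)), ∀ d : Fin D.size,
          (p.1.subtree d (by rw [hi]; exact d.2),
            (⟨D.ar d + p.2.1 - 1, p.2.2 ∘ plug (D.digit d) i⟩ : Maps X Y)) ∈ G}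

theorem RPhi_mono (D : ExtendedIFS X) (E : ExtendedIFS Y)
    {F F' G G' : Set (FTree D E × Maps X Y)}
    (hF : F ⊆ F') (hG : G ⊆ G') : RPhi D E F G ⊆ RPhi D E F' G' := by
  rintro p (⟨e, he, g, h, hf⟩ | ⟨i, hi, h⟩)
  · exact Or.inl ⟨e, he, g, fun k => hF (h k), hf⟩
  · exact Or.inr ⟨i, hi, fun d => hG (h d)⟩

/-- `μ G. RΦ(F)(G)`, as a monotone operator in `F`. -/
def RJ (D : ExtendedIFS X) (E : ExtendedIFS Y) :
    Set (FTree D E × Maps X Y) →o Set (FTree D E × Maps X Y) where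
  toFun F := OrderHom.lfp ⟨RPhi D E F, fun _ _ h => RPhi_mono D E subset_rfl h⟩
  monotone' _ _ h := OrderHom.lfp.monotone fun _ => RPhi_mono D E h subset_rfl

/-- `T` realises the statement `f ∈ ℂ_{𝔽(X, Y)}`. -/
def Realises (D : ExtendedIFS X) (E : ExtendedIFS Y) (T : FTree D E) (f : Maps X Y) : Prop :=
  (T, f) ∈ OrderHom.gfp (RJ D E)

end Realisers

end DigitSpaces

/-! The purely set-theoretic equality is fixed-point theory. As there are only finitely many digits,
the inner least fixed point is exhausted by its finite stages (`exists_mem_iterate_Phi`), so each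
member of the class has a natural number as rank, which drops at reading steps. Unfolding a choice
of steps gives a realiser (`realises_unfold`); conversely the trees can be forgotten
(`mem_CF_of_realises`).

Both computability directions rest on `EffectiveData`. Compactness gives a Lebesgue number for the
cover by the interiors of the ranges, decidability finds a suitable digit at each basic point, and
approximable choice, passed to the limit, gives uniformly continuous right inverses of the digits
with computable approximations.

From a computable tree to an algorithm (`eval_realiser_spec`): the digits of `Y` contract, so
passing `n` writing nodes determines the value up to `K ^ n * B`. At a node reading argument `i`, a
basic approximation of `x i` selects a digit `d`; then `x i` is replaced by its image under the
right inverse of `d` and the evaluation continues in subtree `d`. Moduli of continuity are combined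
from the leaves of the finite part of the tree that has to be inspected. The procedures come from
the recursion theorem (`exists_partrec_rec`), their termination from `Realises.write_induction`.

From a computable map to a tree (`exists_computable_realiser`): each argument is read until
contraction makes the variation of the map small against the Lebesgue number of `Y`. Then one
approximate value selects a digit `e` whose range contains all values; `e` is written, and the
components of the right inverse of `e` applied to the map are treated in the same way. A state
records its history, from which the map at the node can be approximated (`nodeEval`); `StateInv` is
the invariant. A read argument may turn into several, but each of them has been read once more, so
an exponential weight decreases and reading stops. -/

open Encodable Nat.Partrec

namespace DigitSpaces

/-! ### Recursion on computable call trees -/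

/-- The results of evaluating a partial function at the first `n` entries of a list. -/
def seqEval {α σ : Type*} (g : α →. σ) (l : List α) (n : ℕ) : Part (List σ) :=
  n.rec (Part.some []) fun j r => r.bind fun acc =>
    (l[j]? : Part α).bind fun a => (g a).map fun v => acc ++ [v]

theorem mem_seqEval {α σ : Type*} (g : α →. σ) {l : List α} {r : List σ}
    (h : List.Forall₂ (fun a v => v ∈ g a) l r) : r ∈ seqEval g l l.length := by
  suffices H : ∀ n ≤ l.length, r.take n ∈ seqEval g l n by
    simpa [h.length_eq] using H l.length le_rfl
  intro n
  induction n with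
  | zero => intro _; simp [seqEval]
  | succ n ih =>
    intro hn
    have hr : n < r.length := h.length_eq ▸ hn
    refine Part.mem_bind_iff.2 ⟨r.take n, ih (by omega), Part.mem_bind_iff.2 ⟨l[n], ?_, ?_⟩⟩
    · rw [List.getElem?_eq_getElem hn]; exact Part.mem_some _
    · refine (Part.mem_map_iff _).2 ⟨r[n], ?_, by simp⟩
      exact (List.forall₂_iff_get.1 h).2 n hn hr

section Recursion

variable {α β γ σ : Type*} [Primcodable α] [Primcodable β] [Primcodable γ] [Primcodable σ]

/-- The partial function between coded types that is computed by a code. -/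
def evalAs (α σ : Type*) [Primcodable α] [Primcodable σ] (c : Code) (a : α) : Part σ :=
  (c.eval (encode a)).bind fun n => ((decode n : Option σ) : Part σ)

theorem evalAs_partrec : Partrec₂ (evalAs α σ) :=
  (Code.eval_part.comp Computable.fst (Computable.encode.comp Computable.snd)).bind
    (Computable.ofOption (Computable.decode.comp Computable.snd)).to₂

/-- A function can be defined by a recursion in which the (finitely many) recursive calls and the
combination of their results are effective. -/
theorem exists_partrec_rec {q : α →. List α} {c : α → List σ → σ} (hq : Partrec q)
    (hc : Computable₂ c) : ∃ g : α →. σ, Partrec g ∧ ∀ a l r, l ∈ q a →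
      List.Forall₂ (fun a' v => v ∈ g a') l r → c a r ∈ g a := by
  let F : Code → α →. σ := fun k a => (q a).bind fun l =>
    (seqEval (evalAs α σ k) l l.length).map (c a)
  have hF : Partrec₂ F := by
    refine Partrec.bind (hq.comp Computable.snd) (Partrec.map ?_ ?_)
    · refine Partrec.nat_rec (α := (Code × α) × List α) (σ := List σ)
        (g := fun _ => Part.some [])
        (h := fun p s => (p.2[s.1]? : Part α).bind fun a =>
          (evalAs α σ p.1.1 a).map fun v => s.2 ++ [v])
        (Computable.list_length.comp Computable.snd) (Computable.const []) ?_
      refine Partrec.bind (Computable.ofOption (Computable.list_getElem?.comp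
        (Computable.snd.comp Computable.fst) (Computable.fst.comp Computable.snd)))
        (Partrec.map (evalAs_partrec.comp ?_ Computable.snd) ?_)
      · exact Computable.fst.comp (Computable.fst.comp (Computable.fst.comp Computable.fst))
      · exact Computable.list_concat.comp
          (Computable.snd.comp (Computable.snd.comp (Computable.fst.comp Computable.fst)))
          Computable.snd
    · exact hc.comp (Computable.snd.comp (Computable.fst.comp Computable.fst)) Computable.snd
  -- Kleene's recursion theorem gives a code that may call itself. Well-foundedness plays no role
  -- here: values are only propagated from the calls upwards, and termination is left to an
  -- induction in each application.
  obtain ⟨k, hk⟩ := Code.fixed_point₂ (f := fun k n => ((decode n : Option α) : Part α).bind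
    fun a => (F k a).map encode) (by
      refine Partrec.bind (Computable.ofOption (Computable.decode.comp Computable.snd))
        (Partrec.map (hF.comp (Computable.fst.comp Computable.fst) Computable.snd) ?_)
      exact Computable.encode.comp Computable.snd)
  have hfix : ∀ a, evalAs α σ k a = F k a := by
    intro a
    simp only [evalAs, hk, encodek, Part.coe_some, Part.bind_some]
    simp only [Part.bind_map, encodek, Part.coe_some, Part.bind_some_right]
  refine ⟨evalAs α σ k, evalAs_partrec.comp (Computable.const k) Computable.id, ?_⟩
  intro a l r hl hr
  rw [hfix]
  exact Part.mem_bind_iff.2 ⟨l, hl, Part.mem_map _ (mem_seqEval _ hr)⟩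

/-- Recursion over a list with a parameter that changes in the recursive call. -/
theorem computable_list_rec_param {f : List β → γ → σ} {g : γ → σ} {pre : β → γ → γ}
    {post : β → γ → σ → σ} (hg : Computable g) (hpre : Computable₂ pre)
    (hpost : Computable fun p : (β × γ) × σ => post p.1.1 p.1.2 p.2)
    (h_nil : ∀ a, f [] a = g a)
    (h_cons : ∀ b l a, f (b :: l) a = post b a (f l (pre b a))) : Computable₂ f := by
  -- The call tree is a single path: one call for a non-empty list, none for `[]`. Hence the default
  -- `g p.2` for a missing result is never used.
  let q : List β × γ → List (List β × γ) := fun p =>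
    Option.casesOn p.1.head? [] fun b => [(p.1.tail, pre b p.2)]
  let c : List β × γ → List σ → σ := fun p v =>
    Option.casesOn p.1.head? (g p.2) fun b => post b p.2 (v.head?.getD (g p.2))
  have hq : Computable q := by
    refine Computable.option_casesOn (Primrec.list_head?.to_comp.comp Computable.fst)
      (Computable.const []) ?_
    have h1 : Computable fun p : (List β × γ) × β => pre p.2 p.1.2 :=
      hpre.comp Computable.snd (Computable.snd.comp Computable.fst)
    have h2 : Computable fun p : (List β × γ) × β => p.1.1.tail :=
      Primrec.list_tail.to_comp.comp (Computable.fst.comp Computable.fst)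
    exact Computable.list_cons.comp (h2.pair h1) (Computable.const [])
  have hc : Computable₂ c := by
    have h2 : Computable fun p : ((List β × γ) × List σ) × β => p.1.1.2 :=
      Computable.snd.comp (Computable.fst.comp Computable.fst)
    have h3 : Computable fun p : ((List β × γ) × List σ) × β => p.1.2.head?.getD (g p.1.1.2) :=
      Computable.option_getD (Primrec.list_head?.to_comp.comp
          (Computable.snd.comp Computable.fst)) (hg.comp h2)
    have h4 : Computable fun p : ((List β × γ) × List σ) × β =>
        post p.2 p.1.1.2 (p.1.2.head?.getD (g p.1.1.2)) := by
      have h : Computable fun p : ((List β × γ) × List σ) × β => (p.2, p.1.1.2) :=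
        Computable.snd.pair h2
      have h' := hpost.comp (h.pair h3)
      exact h'
    have h5 : Computable fun p : (List β × γ) × List σ => p.1.1.head? :=
      Primrec.list_head?.to_comp.comp (Computable.fst.comp Computable.fst)
    have h6 : Computable fun p : (List β × γ) × List σ => g p.1.2 :=
      hg.comp (Computable.snd.comp Computable.fst)
    exact Computable.option_casesOn h5 h6 h4.to₂
  obtain ⟨r, hr, hspec⟩ := exists_partrec_rec (Computable.partrec hq) hc
  refine Partrec.of_eq_tot hr ?_
  rintro ⟨l, a⟩
  induction l generalizing a with
  | nil =>
    rw [h_nil]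
    exact hspec ([], a) [] [] (Part.mem_some _) List.Forall₂.nil
  | cons b l ih =>
    rw [h_cons]
    exact hspec (b :: l, a) [(l, pre b a)] [f l (pre b a)] (Part.mem_some _)
      (List.Forall₂.cons (ih _) List.Forall₂.nil)

/-- A family of computable functions indexed by a finite ordinal is computable. -/
theorem computable_fin_cases {n : ℕ} {f : Fin n → α → σ} (hf : ∀ i, Computable (f i)) :
    Computable₂ f :=
  (Computable.vector_get.comp ((Computable.vector_ofFn hf).comp Computable.snd)
    Computable.fst).of_eq fun p => by simp

end Recursion

/-! ### Unfolding a labelled transition system into a tree -/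

namespace LTree

variable {A S : Type*} {ar : A → ℕ}

theorem ext_label {T T' : LTree A ar} (h : ∀ s, T.label s = T'.label s) : T = T' := by
  cases T; cases T'
  congr
  exact funext h

/-- The label found by following an address in a transition system. -/
def unfoldLabel (ar : A → ℕ) (lab : S → A) (child : S → ℕ → S) : List ℕ → S → Option A
  | [], σ => some (lab σ)
  | i :: s, σ => if i < ar (lab σ) then unfoldLabel ar lab child s (child σ i) else none

/-- The tree of all runs of a transition system from a given state. -/
def unfold (ar : A → ℕ) (lab : S → A) (child : S → ℕ → S) (σ : S) : LTree A ar where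
  label s := unfoldLabel ar lab child s σ
  root_isSome := rfl
  compatible s i := by
    induction s generalizing σ with
    | nil => by_cases h : i < ar (lab σ) <;> simp [unfoldLabel, h]
    | cons j s ih =>
      by_cases h : j < ar (lab σ)
      · simpa [unfoldLabel, h] using ih (child σ j)
      · simp [unfoldLabel, h]

@[simp]
theorem root_unfold (lab : S → A) (child : S → ℕ → S) (σ : S) :
    (unfold ar lab child σ).root = lab σ := rfl

theorem subtree_unfold (lab : S → A) (child : S → ℕ → S) (σ : S) (i : ℕ)
    (hi : i < ar (unfold ar lab child σ).root) :
    (unfold ar lab child σ).subtree i hi = unfold ar lab child (child σ i) := by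
  refine ext_label fun s => ?_
  exact if_pos hi

end LTree

/-! ### Coinduction for realisers -/

section Class

variable {X : Type*} [TopologicalSpace X] {Y : Type*} [TopologicalSpace Y]
  {D : ExtendedIFS X} {E : ExtendedIFS Y}

/-- An unfolded transition system realises every map that is related to its initial state, if
transitions preserve the relation and read transitions decrease a rank. -/
theorem realises_unfold {S : Type*} {lab : S → Label E} {child : S → ℕ → S}
    {I : S → Maps X Y → Prop} {rk : S → ℕ}
    (hstep : ∀ σ f, I σ f →
      (∃ e, lab σ = Sum.inl e ∧ ∃ g : Fin (E.ar e) → (Fin f.1 → X) → Y,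
        (∀ k : Fin (E.ar e), I (child σ k) ⟨f.1, g k⟩) ∧
          f.2 = fun x => E.digit e fun k => g k x) ∨
      ∃ i : Fin f.1, lab σ = Sum.inr (i : ℕ) ∧ ∀ d : Fin D.size, rk (child σ d) < rk σ ∧
        I (child σ d) ⟨D.ar d + f.1 - 1, f.2 ∘ plug (D.digit d) i⟩)
    {σ : S} {f : Maps X Y} (h : I σ f) :
    Realises D E (LTree.unfold (labelAr D E) lab child σ) f := by
  let R : Set (FTree D E × Maps X Y) :=
    {p | ∃ σ, I σ p.2 ∧ p.1 = LTree.unfold (labelAr D E) lab child σ}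
  suffices hR : R ≤ RJ D E R from OrderHom.le_gfp _ hR ⟨σ, h, rfl⟩
  rintro ⟨T, f⟩ ⟨σ, hI, hT⟩
  dsimp only at hI hT
  subst hT
  -- Between two writing nodes the inner least fixed point needs a genuine induction, carried by the
  -- rank. At a writing node membership in `R` is enough.
  induction hn : rk σ using Nat.strong_induction_on generalizing σ f with
  | _ n ih =>
    change _ ∈ OrderHom.lfp _
    rw [← OrderHom.map_lfp]
    rcases hstep σ f hI with ⟨e, he, g, hg, hf⟩ | ⟨i, hi, hd⟩
    · refine Or.inl ⟨e, he, g, fun k => ⟨child σ k, hg k, ?_⟩, hf⟩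
      exact LTree.subtree_unfold lab child σ k (by rw [LTree.root_unfold, he]; exact k.2)
    · refine Or.inr ⟨i, hi, fun d => ?_⟩
      have := ih _ (hn ▸ (hd d).1) _ (child σ d) (hd d).2 rfl
      dsimp only
      rw [LTree.subtree_unfold]
      exact this

theorem Phi_CF : Phi D E (CF D E) (CF D E) = CF D E := by
  have h : CF D E = OrderHom.lfp ⟨Phi D E (CF D E), fun _ _ h => Phi_mono D E subset_rfl h⟩ :=
    (OrderHom.map_gfp (J D E)).symm
  have h' := OrderHom.map_lfp ⟨Phi D E (CF D E), fun _ _ h => Phi_mono D E subset_rfl h⟩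
  rw [← h] at h'
  exact h'

/-- The finite stages of the inner induction exhaust the class. -/
theorem exists_mem_iterate_Phi {f : Maps X Y} (hf : f ∈ CF D E) :
    ∃ n, f ∈ (Phi D E (CF D E))^[n] ∅ := by
  have hmono : Monotone fun n => (Phi D E (CF D E))^[n] ∅ :=
    Monotone.monotone_iterate_of_le_map (fun _ _ h => Phi_mono D E subset_rfl h)
      (Set.empty_subset _)
  have h : CF D E ≤ OrderHom.lfp
      ⟨Phi D E (CF D E), fun _ _ h => Phi_mono D E subset_rfl h⟩ :=
    (OrderHom.map_gfp (J D E)).ge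
  have h' : OrderHom.lfp ⟨Phi D E (CF D E), fun _ _ h => Phi_mono D E subset_rfl h⟩ ≤
      ⋃ n, (Phi D E (CF D E))^[n] ∅ := by
    refine OrderHom.lfp_le _ ?_
    rintro f (hw | ⟨i, hi⟩)
    · exact Set.mem_iUnion.2 ⟨1, Or.inl hw⟩
    -- Finiteness of the set of digits enters here: the stages of the finitely many premises have a
    -- common upper bound.
    · choose n hn using fun d => Set.mem_iUnion.1 (hi d)
      refine Set.mem_iUnion.2 ⟨Finset.univ.sup n + 1, ?_⟩
      rw [Function.iterate_succ_apply']
      exact Or.inr ⟨i, fun d => hmono (Finset.le_sup (Finset.mem_univ d)) (hn d)⟩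
  exact Set.mem_iUnion.1 (h' (h hf))

theorem iterate_Phi_subset_CF (n : ℕ) : (Phi D E (CF D E))^[n] ∅ ⊆ CF D E := by
  induction n with
  | zero => exact Set.empty_subset _
  | succ n ih =>
    rw [Function.iterate_succ_apply']
    exact (Phi_mono D E subset_rfl ih).trans Phi_CF.subset

/-- Every member of the class is realised by some tree. -/
theorem exists_realises_of_mem_CF {f : Maps X Y} (hf : f ∈ CF D E) :
    ∃ T : FTree D E, Realises D E T f := by
  classical
  -- The rank is the least stage containing the map. It is positive because stage `0` is empty, and
  -- the premises of a read step lie one stage lower.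
  let rk : CF D E → ℕ := fun f => Nat.find (exists_mem_iterate_Phi f.2)
  have key : ∀ f : CF D E, ∃ (a : Label E) (ch : ℕ → CF D E),
      (∃ e, a = Sum.inl e ∧ ∃ g : Fin (E.ar e) → (Fin f.1.1 → X) → Y,
        (∀ k : Fin (E.ar e), (ch k).1 = ⟨f.1.1, g k⟩) ∧
          f.1.2 = fun x => E.digit e fun k => g k x) ∨
      ∃ i : Fin f.1.1, a = Sum.inr (i : ℕ) ∧ ∀ d : Fin D.size, rk (ch d) < rk f ∧
        (ch d).1 = ⟨D.ar d + f.1.1 - 1, f.1.2 ∘ plug (D.digit d) i⟩ := by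
    intro f
    have hspec := Nat.find_spec (exists_mem_iterate_Phi f.2)
    obtain ⟨n, hn⟩ : ∃ n, rk f = n + 1 := by
      refine Nat.exists_eq_succ_of_ne_zero fun h0 => ?_
      change f.1 ∈ (Phi D E (CF D E))^[rk f] ∅ at hspec
      rw [h0] at hspec
      exact hspec
    change f.1 ∈ (Phi D E (CF D E))^[rk f] ∅ at hspec
    rw [hn, Function.iterate_succ_apply'] at hspec
    rcases hspec with ⟨e, g, hg, hfg⟩ | ⟨i, hi⟩
    -- Children with numbers beyond the arity are irrelevant and get the default `f`.
    · refine ⟨Sum.inl e, fun k => if h : k < E.ar e then ⟨_, hg ⟨k, h⟩⟩ else f,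
        Or.inl ⟨e, rfl, g, fun k => ?_, hfg⟩⟩
      simp
    · refine ⟨Sum.inr i, fun d => if h : d < D.size then
        ⟨_, iterate_Phi_subset_CF n (hi ⟨d, h⟩)⟩ else f, Or.inr ⟨i, rfl, fun d => ⟨?_, by simp⟩⟩⟩
      rw [hn, Nat.lt_succ_iff]
      refine Nat.find_min' _ ?_
      simpa using hi d
  choose lab child hstep using key
  refine ⟨LTree.unfold (labelAr D E) lab child ⟨f, hf⟩, realises_unfold (rk := rk)
    (I := fun σ f => σ.1 = f) ?_ rfl⟩
  rintro σ _ rfl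
  exact hstep σ

/-- The set of maps that have some realiser is a post-fixed point of `J`: the outer unfolding of the
realiser is one step, and its inner least fixed point is projected by induction. -/
theorem mem_CF_of_realises {T : FTree D E} {f : Maps X Y} (h : Realises D E T f) :
    f ∈ CF D E := by
  let S : Set (Maps X Y) := {f | ∃ T, Realises D E T f}
  suffices hS : S ≤ J D E S from OrderHom.le_gfp _ hS ⟨T, h⟩
  rintro f ⟨T, hT⟩
  have h1 : (T, f) ∈ RJ D E (OrderHom.gfp (RJ D E)) := (OrderHom.map_gfp (RJ D E)).ge hT
  have h2 : RJ D E (OrderHom.gfp (RJ D E)) ≤ {p | p.2 ∈ J D E S} := by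
    refine OrderHom.lfp_le _ ?_
    rintro ⟨T, f⟩ hp
    refine (OrderHom.map_lfp ⟨Phi D E S, fun _ _ h => Phi_mono D E subset_rfl h⟩).le ?_
    rcases hp with ⟨e, he, g, hg, hf⟩ | ⟨i, hi, hd⟩
    · exact Or.inl ⟨e, g, fun k => ⟨_, hg k⟩, hf⟩
    · exact Or.inr ⟨i, fun d => hd d⟩
  exact h2 h1

/-- Induction along a realiser: outer induction on the number of writing nodes to be passed, inner
induction over the reading nodes in between. -/
theorem Realises.write_induction {P : ℕ → FTree D E → Maps X Y → Prop}
    (zero : ∀ T f, P 0 T f)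
    (write : ∀ n T f e (he : T.root = Sum.inl e) (g : Fin (E.ar e) → (Fin f.1 → X) → Y),
      (∀ k : Fin (E.ar e), P n (T.subtree k (by rw [he]; exact k.2)) ⟨f.1, g k⟩) →
      (f.2 = fun x => E.digit e fun k => g k x) → P (n + 1) T f)
    (read : ∀ n T f (i : Fin f.1) (hi : T.root = Sum.inr (i : ℕ)),
      (∀ d : Fin D.size, P (n + 1) (T.subtree d (by rw [hi]; exact d.2))
        ⟨D.ar d + f.1 - 1, f.2 ∘ plug (D.digit d) i⟩) → P (n + 1) T f)
    (n : ℕ) {T : FTree D E} {f : Maps X Y} (h : Realises D E T f) : P n T f := by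
  induction n generalizing T f with
  | zero => exact zero T f
  | succ n ih =>
    have h1 : (T, f) ∈ RJ D E (OrderHom.gfp (RJ D E)) := (OrderHom.map_gfp (RJ D E)).ge h
    have h2 : RJ D E (OrderHom.gfp (RJ D E)) ≤ {p | P (n + 1) p.1 p.2} := by
      refine OrderHom.lfp_le _ ?_
      rintro ⟨T, f⟩ hp
      rcases hp with ⟨e, he, g, hg, hf⟩ | ⟨i, hi, hd⟩
      · exact write n T f e he g (fun k => ih (hg k)) hf
      · exact read n T f i hi fun d => hd d
    exact h2 h1

end Class

/-! ### Dyadic precision -/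

/-- A code of the rational `2⁻ᵏ`. -/
def dyadic (k : ℕ) : ℕ × ℕ := (0, 2 ^ k - 1)

theorem posRat_dyadic (k : ℕ) : posRat (dyadic k) = (1 / 2 : ℝ) ^ k := by
  have : ((2 ^ k - 1 : ℕ) : ℝ) = 2 ^ k - 1 := by
    rw [Nat.cast_sub Nat.one_le_two_pow]; norm_num
  simp [posRat, dyadic, this]

theorem computable_dyadic : Computable dyadic := by
  have hpow : Primrec fun k : ℕ => 2 ^ k :=
    (Primrec₂.unpaired'.1 Nat.Primrec.pow).comp (Primrec.const 2) Primrec.id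
  exact (Primrec.pair (Primrec.const 0) (Primrec.nat_sub.comp hpow (Primrec.const 1))).to_comp

/-- This makes the second component of any code the exponent of a dyadic lower bound, so rational
precisions can be traded for exponents without searching. -/
theorem half_pow_le_posRat (c : ℕ × ℕ) : (1 / 2 : ℝ) ^ c.2 ≤ posRat c := by
  have h1 : (c.2 : ℝ) + 1 ≤ 2 ^ c.2 := by exact_mod_cast Nat.lt_two_pow_self
  have h2 : (0 : ℝ) < (c.2 : ℝ) + 1 := by positivity
  rw [posRat, one_div, inv_pow, inv_eq_one_div, div_le_div_iff₀ (by positivity) h2]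
  have h3 : (0 : ℝ) ≤ c.1 := by positivity
  nlinarith

theorem posRat_pos (c : ℕ × ℕ) : 0 < posRat c :=
  lt_of_lt_of_le (by positivity) (half_pow_le_posRat c)

theorem half_pow_anti {k l : ℕ} (h : k ≤ l) : (1 / 2 : ℝ) ^ l ≤ (1 / 2 : ℝ) ^ k :=
  pow_le_pow_of_le_one (by norm_num) (by norm_num) h

theorem half_pow_succ (k : ℕ) : (1 / 2 : ℝ) ^ (k + 1) = (1 / 2 : ℝ) ^ k / 2 := by
  rw [pow_succ]; ring

theorem half_pow_pos (k : ℕ) : (0 : ℝ) < (1 / 2 : ℝ) ^ k := by positivity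

/-! ### Tuples of basic points coded by lists -/

/-- The tuple of basic points whose indices are the entries of a list (padded by `0`). -/
def tuple {X : Type*} (Q : ℕ → X) (l : List ℕ) (m : ℕ) : Fin m → X := fun j => Q (l.getD j 0)

theorem computable_listToFin (m : ℕ) :
    Computable fun (l : List ℕ) (j : Fin m) => l.getD (j : ℕ) 0 :=
  Primrec.to_comp (Primrec.fin_curry.2
    ((Primrec.list_getD 0).comp Primrec.fst (Primrec.fin_val.comp Primrec.snd)))

theorem computable_ofFn (m : ℕ) : Computable fun u : Fin m → ℕ => List.ofFn u :=
  (Primrec.vector_toList.comp Primrec.vector_ofFn').to_comp.of_eq fun u => by simp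

section Maps

variable {X : Type*} [MetricSpace X] {Y : Type*} [MetricSpace Y]

theorem tuple_ofFn {X : Type*} (Q : ℕ → X) {m : ℕ} (u : Fin m → ℕ) :
    tuple Q (List.ofFn u) m = fun j => Q (u j) := by
  funext j
  simp [tuple]

theorem exists_tuple_near {Q : ℕ → X} (hQ : DenseRange Q) {m : ℕ} (x : Fin m → X) {ε : ℝ}
    (hε : 0 < ε) : ∃ l : List ℕ, l.length = m ∧ dist x (tuple Q l m) < ε := by
  choose u hu using fun j => hQ.exists_dist_lt (x j) hε
  refine ⟨List.ofFn u, by simp, ?_⟩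
  rw [tuple_ofFn, dist_pi_lt_iff hε]
  exact hu

/-- Computability of maps, with dyadic precision and lists in place of tuples. -/
theorem isComputableMap_iff {Q : ℕ → X} {Q' : ℕ → Y} {m : ℕ} {h : (Fin m → X) → Y} :
    IsComputableMap Q Q' h ↔
      (∃ ζ : ℕ → ℕ, Computable ζ ∧
        ∀ k x y, dist x y < (1 / 2 : ℝ) ^ ζ k → dist (h x) (h y) < (1 / 2 : ℝ) ^ k) ∧
      ∃ G : List ℕ → ℕ → ℕ, Computable₂ G ∧
        ∀ l k, l.length = m → dist (h (tuple Q l m)) (Q' (G l k)) < (1 / 2 : ℝ) ^ k := by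
  constructor
  · rintro ⟨⟨ζ, hζ, hζ'⟩, G, hG, hG'⟩
    refine ⟨⟨fun k => (ζ (dyadic k)).2, Computable.snd.comp (hζ.comp computable_dyadic),
      fun k x y hxy => ?_⟩, fun l k => G (fun j => l.getD (j : ℕ) 0, k), ?_, fun l k _ => hG' _ k⟩
    · rw [← posRat_dyadic]
      exact hζ' _ x y (hxy.trans_le (half_pow_le_posRat _))
    · exact hG.comp (((computable_listToFin m).comp Computable.fst).pair Computable.snd)
  · rintro ⟨⟨ζ, hζ, hζ'⟩, G, hG, hG'⟩
    refine ⟨⟨fun ε => dyadic (ζ ε.2), computable_dyadic.comp (hζ.comp Computable.snd),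
      fun ε x y hxy => ?_⟩, fun p => G (List.ofFn p.1) p.2, ?_, fun u k => ?_⟩
    · rw [posRat_dyadic] at hxy
      exact (hζ' _ x y hxy).trans_le (half_pow_le_posRat _)
    · exact hG.comp ((computable_ofFn m).comp Computable.fst) Computable.snd
    · have := hG' (List.ofFn u) k (by simp)
      rwa [tuple_ofFn] at this

end Maps

/-! ### Continuous right inverses of digits -/

section Section

variable {X : Type*} [MetricSpace X] [CompactSpace X]

open Filter Topology

/-- The approximations given by approximable choice converge to a right inverse. -/
theorem exists_section {Q : ℕ → X} (hQ : DenseRange Q) {n : ℕ} {φ : (Fin n → X) → X}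
    (hφ : Continuous φ) (v : ℕ × ℕ → ℕ → Fin n → ℕ) (t : ℕ × ℕ → ℕ × ℕ)
    (h₁ : ∀ θ u, Q u ∈ interior (Set.range φ) → ∀ θ₁ : ℕ × ℕ,
      dist (fun k => Q (v θ u k)) (fun k => Q (v θ₁ u k)) < max (posRat θ) (posRat θ₁))
    (h₂ : ∀ θ u u', Q u ∈ interior (Set.range φ) → Q u' ∈ interior (Set.range φ) →
      dist (Q u) (Q u') < posRat (t θ) →
      dist (fun k => Q (v θ u k)) (fun k => Q (v θ u' k)) < posRat θ)
    (h₃ : ∀ θ u, Q u ∈ interior (Set.range φ) →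
      ∃ y : Fin n → X, φ y = Q u ∧ dist y (fun k => Q (v θ u k)) < posRat θ)
    {x : X} (hx : x ∈ interior (Set.range φ)) :
    ∃ y : Fin n → X, φ y = x ∧ ∀ θ u, Q u ∈ interior (Set.range φ) →
      dist x (Q u) < posRat (t θ) → dist y (fun k => Q (v θ u k)) ≤ 2 * posRat θ := by
  obtain ⟨ε, hε, hball⟩ := Metric.isOpen_iff.1 isOpen_interior x hx
  choose u hu using fun j : ℕ => hQ.exists_dist_lt x (lt_min hε (half_pow_pos j))
  have hint : ∀ j, Q (u j) ∈ interior (Set.range φ) := fun j => hball <| by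
    rw [Metric.mem_ball, dist_comm]; exact (hu j).trans_le (min_le_left _ _)
  have hpow : Tendsto (fun j : ℕ => (1 / 2 : ℝ) ^ j) atTop (𝓝 0) :=
    tendsto_pow_atTop_nhds_zero_of_lt_one (by norm_num) (by norm_num)
  have hux : Tendsto (fun j => Q (u j)) atTop (𝓝 x) := by
    rw [tendsto_iff_dist_tendsto_zero]
    refine squeeze_zero (fun _ => dist_nonneg) (fun j => ?_) hpow
    rw [dist_comm]; exact (hu j).le.trans (min_le_right _ _)
  let z : ℕ → Fin n → X := fun j k => Q (v (dyadic j) (u j) k)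
  -- Approximate preimages of basic points converging to `x` have a cluster point by compactness. By
  -- the third condition and continuity it is a preimage of `x`.
  obtain ⟨y, ψ, hψ, hy⟩ := CompactSpace.tendsto_subseq z
  refine ⟨y, ?_, ?_⟩
  · choose y' hy' hyz using fun j => h₃ (dyadic j) (u j) (hint j)
    have hlim : Tendsto (y' ∘ ψ) atTop (𝓝 y) := by
      refine (tendsto_iff_of_dist ?_).2 hy
      refine squeeze_zero (fun _ => dist_nonneg) (fun j => ?_) (hpow.comp hψ.tendsto_atTop)
      have := (hyz (ψ j)).le
      rwa [posRat_dyadic] at this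
    have h := (hφ.tendsto y).comp hlim
    refine tendsto_nhds_unique h ?_
    refine (hux.comp hψ.tendsto_atTop).congr fun j => ?_
    exact (hy' (ψ j)).symm
  · intro θ w hw hxw
    have hd : Tendsto (fun j => dist (z (ψ j)) fun k => Q (v θ w k)) atTop
        (𝓝 (dist y fun k => Q (v θ w k))) := hy.dist tendsto_const_nhds
    refine le_of_tendsto hd ?_
    have e1 : ∀ᶠ j in atTop, (1 / 2 : ℝ) ^ ψ j < posRat θ :=
      (hpow.comp hψ.tendsto_atTop).eventually (gt_mem_nhds (posRat_pos θ))
    have e2 : ∀ᶠ j in atTop, dist (Q (u (ψ j))) (Q w) < posRat (t θ) :=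
      ((hux.comp hψ.tendsto_atTop).dist tendsto_const_nhds).eventually (gt_mem_nhds hxw)
    -- The factor `2` has one `θ` from changing the precision at a fixed basic point (first
    -- condition) and one from changing the basic point at a fixed precision (second condition).
    filter_upwards [e1, e2] with j hj1 hj2
    have a1 := h₁ (dyadic (ψ j)) (u (ψ j)) (hint _) θ
    rw [posRat_dyadic, max_eq_right hj1.le] at a1
    have a2 := h₂ θ _ _ (hint (ψ j)) hw hj2
    have a3 := dist_triangle (z (ψ j)) (fun k => Q (v θ (u (ψ j)) k)) fun k => Q (v θ w k)
    change dist (z (ψ j)) _ < _ at a1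
    linarith

end Section

/-! ### Effective data of a digit space -/

section Effective

variable {X : Type*} [MetricSpace X]

/-- The effective content of a decidable well-covering computable digit space with approximable
choice: a contraction factor, a Lebesgue number `2⁻ˡ` of the cover by the ranges, continuous right
inverses of the digits with their approximations, and approximations of the digits. -/
structure EffectiveData (D : ExtendedIFS X) (Q : ℕ → X) where
  dense : DenseRange Q
  /-- A common contraction factor. -/
  K : ℝ
  K_nonneg : 0 ≤ K
  K_lt_one : K < 1
  dist_digit : ∀ d x y, dist (D.digit d x) (D.digit d y) ≤ K * dist x y
  /-- A bound of the diameter. -/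
  B : ℝ
  dist_le : ∀ x y : X, dist x y ≤ B
  /-- The number of contractions needed for a given precision. -/
  depth : ℕ → ℕ
  computable_depth : Computable depth
  depth_spec : ∀ k n, depth k ≤ n → K ^ n * B < (1 / 2 : ℝ) ^ k
  /-- The exponent of a Lebesgue number. -/
  leb : ℕ
  /-- A digit whose range contains a ball around a basic point. -/
  sel : ℕ → Fin D.size
  computable_sel : Computable sel
  ball_sel : ∀ u, Metric.ball (Q u) ((1 / 2 : ℝ) ^ leb) ⊆ Set.range (D.digit (sel u))
  /-- Right inverses of the digits. -/
  sec : (d : Fin D.size) → X → Fin (D.ar d) → X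
  digit_sec : ∀ d x, x ∈ interior (Set.range (D.digit d)) → D.digit d (sec d x) = x
  /-- A modulus of continuity for the right inverses. -/
  om : ℕ → ℕ
  computable_om : Computable om
  le_om : ∀ k, k ≤ om k
  leb_le_om : ∀ k, leb + 2 ≤ om k
  dist_sec : ∀ d k x x', x ∈ interior (Set.range (D.digit d)) →
    x' ∈ interior (Set.range (D.digit d)) → dist x x' < (1 / 2 : ℝ) ^ om k →
    dist (sec d x) (sec d x') < (1 / 2 : ℝ) ^ k
  /-- Approximations of the right inverses. -/
  choice : Fin D.size → ℕ × ℕ → List ℕ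
  computable_choice : Computable₂ choice
  length_choice : ∀ d p, (choice d p).length = D.ar d
  -- Half the Lebesgue number is used as radius, since the digit may have been selected at another
  -- basic point near `u` than the one at which the right inverse is approximated.
  choice_spec : ∀ d k u, Metric.ball (Q u) ((1 / 2 : ℝ) ^ (leb + 1)) ⊆ Set.range (D.digit d) →
    ∀ x ∈ interior (Set.range (D.digit d)), dist x (Q u) < (1 / 2 : ℝ) ^ om k →
    dist (sec d x) (tuple Q (choice d (k, u)) (D.ar d)) < (1 / 2 : ℝ) ^ k
  /-- Approximations of the digits. -/
  appr : Fin D.size → List ℕ × ℕ → ℕ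
  computable_appr : Computable₂ appr
  appr_spec : ∀ d l k, l.length = D.ar d →
    dist (D.digit d (tuple Q l (D.ar d))) (Q (appr d (l, k))) < (1 / 2 : ℝ) ^ k

theorem ball_subset_interior {x : X} {r : ℝ} {s : Set X} (h : Metric.ball x r ⊆ s) :
    Metric.ball x r ⊆ interior s :=
  interior_maximal h Metric.isOpen_ball

/-- Searching for an element of a finite ordinal with a decidable property. -/
theorem exists_computable_fin_selector {n : ℕ} {p : ℕ → Fin n → Prop}
    (hp : ComputablePred fun q : ℕ × Fin n => p q.1 q.2) (h : ∀ u, ∃ d, p u d) :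
    ∃ s : ℕ → Fin n, Computable s ∧ ∀ u, p u (s u) := by
  obtain ⟨hdec, hcomp⟩ := hp
  obtain ⟨d₀, -⟩ := h 0
  let test : ℕ → Fin n → Bool := fun u d => @decide (p u d) (hdec (u, d))
  have htest : ∀ d, Computable fun u => test u d := fun d =>
    hcomp.comp (Computable.id.pair (Computable.const d))
  let find : List (Fin n) → ℕ → Fin n := fun l u =>
    l.foldr (fun d r => cond (test u d) d r) d₀
  -- The induction runs over a fixed list outside the computation, so only the test for each single
  -- digit has to be computable.
  have hfind : ∀ l, Computable (find l) := by
    intro l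
    induction l with
    | nil => exact Computable.const d₀
    | cons d l ih => exact Computable.cond (htest d) (Computable.const d) ih
  have hspec : ∀ l u, (∃ d ∈ l, p u d) → p u (find l u) := by
    intro l u
    induction l with
    | nil => simp
    | cons d l ih =>
      intro hex
      change p u (cond (test u d) d (find l u))
      by_cases hd : p u d
      · have : test u d = true := by simpa [test] using hd
        rwa [this]
      · have : test u d = false := by simpa [test] using hd
        rw [this]
        refine ih ?_
        obtain ⟨d', hd', hpd⟩ := hex
        rcases List.mem_cons.1 hd' with rfl | hd'
        · exact absurd hpd hd
        · exact ⟨d', hd', hpd⟩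
  refine ⟨find (List.finRange n), hfind _, fun u => hspec _ u ?_⟩
  obtain ⟨d, hd⟩ := h u
  exact ⟨d, List.mem_finRange d, hd⟩

theorem exists_contraction_factor {D : ExtendedIFS X} (h : IsDigitSpace D) :
    ∃ K : ℝ, 0 ≤ K ∧ K < 1 ∧
      ∀ d x y, dist (D.digit d x) (D.digit d y) ≤ K * dist x y := by
  choose K hK hL using h.contracting
  refine ⟨(Finset.univ.sup K : NNReal), NNReal.coe_nonneg _, ?_, fun d x y => ?_⟩
  · exact_mod_cast (Finset.sup_lt_iff (by simp)).2 fun d _ => hK d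
  · refine ((hL d).dist_le_mul x y).trans (mul_le_mul_of_nonneg_right ?_ dist_nonneg)
    exact_mod_cast Finset.le_sup (f := K) (Finset.mem_univ d)

/-- If `K ^ a < 1 / 2` and `B < 2 ^ b`, then `a * (k + b)` contractions suffice. Only the integers
`a` and `b` enter the algorithm, so the reals `K` and `B` need not be computable. -/
theorem exists_computable_depth {K B : ℝ} (h0 : 0 ≤ K) (h1 : K < 1) :
    ∃ N : ℕ → ℕ, Computable N ∧ ∀ k n, N k ≤ n → K ^ n * B < (1 / 2 : ℝ) ^ k := by
  obtain ⟨a, ha⟩ := exists_pow_lt_of_lt_one (show (0 : ℝ) < 1 / 2 by norm_num) h1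
  obtain ⟨b, hb⟩ := pow_unbounded_of_one_lt B (show (1 : ℝ) < 2 by norm_num)
  refine ⟨fun k => a * (k + b), ?_, fun k n hn => ?_⟩
  · exact (Primrec.nat_mul.comp (Primrec.const a)
      (Primrec.nat_add.comp Primrec.id (Primrec.const b))).to_comp
  · have h2 : K ^ n ≤ (1 / 2 : ℝ) ^ (k + b) := by
      refine (pow_le_pow_of_le_one h0 h1.le hn).trans ?_
      rw [pow_mul]
      exact pow_le_pow_left₀ (pow_nonneg h0 _) ha.le _
    have h3 : (1 / 2 : ℝ) ^ (k + b) * 2 ^ b = (1 / 2 : ℝ) ^ k := by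
      rw [pow_add, mul_assoc, ← mul_pow]; norm_num
    have h4 : (0 : ℝ) ≤ K ^ n := pow_nonneg h0 n
    have h5 := half_pow_pos (k + b)
    -- The sign of `B` is not known, hence the maximum with `0`.
    calc K ^ n * B ≤ K ^ n * max B 0 := by gcongr; exact le_max_left _ _
      _ ≤ (1 / 2 : ℝ) ^ (k + b) * max B 0 := by gcongr
      _ < (1 / 2 : ℝ) ^ (k + b) * 2 ^ b := by
        gcongr
        exact max_lt hb (by positivity)
      _ = _ := h3

theorem exists_computable_bound {n : ℕ} {f : Fin n → ℕ → ℕ} (hf : ∀ d, Computable (f d)) (c : ℕ) :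
    ∃ g : ℕ → ℕ, Computable g ∧ (∀ k, k ≤ g k) ∧ (∀ k, c ≤ g k) ∧ ∀ d k, f d k ≤ g k := by
  have hadd := Primrec.nat_add.to_comp
  have key : ∀ l : List (Fin n), Computable fun k => l.foldr (fun d r => f d k + r) (k + c) := by
    intro l
    induction l with
    | nil => exact hadd.comp Computable.id (Computable.const c)
    | cons d l ih => exact hadd.comp (hf d) ih
  have le : ∀ (l : List (Fin n)) k, k + c ≤ l.foldr (fun d r => f d k + r) (k + c) := by
    intro l k
    induction l with
    | nil => exact le_rfl
    | cons d l ih => exact ih.trans (Nat.le_add_left _ _)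
  have le' : ∀ (l : List (Fin n)) k, ∀ d ∈ l, f d k ≤ l.foldr (fun d r => f d k + r) (k + c) := by
    intro l k
    induction l with
    | nil => simp
    | cons d l ih =>
      intro d' hd'
      rcases List.mem_cons.1 hd' with rfl | hd'
      · exact Nat.le_add_right _ _
      · exact (ih d' hd').trans (Nat.le_add_left _ _)
  refine ⟨_, key (List.finRange n), fun k => ?_, fun k => ?_, fun d k => ?_⟩
  · exact (Nat.le_add_right _ _).trans (le _ k)
  · exact (Nat.le_add_left _ _).trans (le _ k)
  · exact le' _ k d (List.mem_finRange d)

theorem exists_lebesgue_exponent {D : ExtendedIFS X} (h : IsDigitSpace D) (hwc : IsWellCovering D) :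
    ∃ l : ℕ, ∀ x : X, ∃ d, Metric.ball x ((1 / 2 : ℝ) ^ l) ⊆ Set.range (D.digit d) := by
  have := h.compact
  obtain ⟨δ, hδ, hleb⟩ := lebesgue_number_lemma_of_metric (s := (Set.univ : Set X)) isCompact_univ
    (c := fun d => interior (Set.range (D.digit d))) (fun _ => isOpen_interior)
    (fun x _ => Set.mem_iUnion.2 (hwc x))
  obtain ⟨l, hl⟩ := exists_pow_lt_of_lt_one hδ (show (1 / 2 : ℝ) < 1 by norm_num)
  refine ⟨l, fun x => ?_⟩
  obtain ⟨d, hd⟩ := hleb x (Set.mem_univ x)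
  exact ⟨d, (Metric.ball_subset_ball hl.le).trans (hd.trans interior_subset)⟩

theorem nonempty_effectiveData {D : ExtendedIFS X} {Q : ℕ → X} (h : IsComputableDigitSpace D Q)
    (hdec : IsDecidable D Q) (hwc : IsWellCovering D) (hac : HasApproximableChoice D Q) :
    Nonempty (EffectiveData D Q) := by
  classical
  have hcompact := h.digitSpace.compact
  have hdense := h.computableMetric.dense
  obtain ⟨K, hK0, hK1, hK⟩ := exists_contraction_factor h.digitSpace
  obtain ⟨B, hB⟩ := Metric.isBounded_iff.1 (isCompact_univ (X := X)).isBounded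
  obtain ⟨N, hN, hN'⟩ := exists_computable_depth (B := B) hK0 hK1
  obtain ⟨l, hl⟩ := exists_lebesgue_exponent h.digitSpace hwc
  have hdec' : ∀ k, ComputablePred fun p : ℕ × Fin D.size =>
      Metric.ball (Q p.1) ((1 / 2 : ℝ) ^ k) ⊆ Set.range (D.digit p.2) := by
    intro k
    obtain ⟨i, hi⟩ := hdec
    refine ⟨fun p => Classical.dec _, ?_⟩
    refine (hi.comp (Computable.fst.pair ((Computable.const (dyadic k)).pair
      Computable.snd))).of_eq fun p => ?_
    exact decide_eq_decide.2 (by simp only [posRat_dyadic])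
  obtain ⟨sel, hsel, hsel'⟩ := exists_computable_fin_selector (hdec' l) fun u => hl (Q u)
  choose v p t hp ht hvp hv using hac
  choose! sec hsec hsec' using fun d (x : X) (hx : x ∈ interior (Set.range (D.digit d))) =>
    exists_section hdense (D.continuous_digit d) (v d) (t d) (fun θ => (hv d θ).1)
      (fun θ => (hv d θ).2.1) (fun θ => (hv d θ).2.2) hx
  -- Precision `k + 3` leaves `2⁻⁽ᵏ⁺²⁾` after the factor `2` of `exists_section`, and `2⁻⁽ᵏ⁺¹⁾` when
  -- two points are compared through a common basic point.
  obtain ⟨om, hom, hle, hlel, homt⟩ := exists_computable_bound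
    (f := fun d k => (t d (dyadic (k + 3))).2)
    (fun d => Computable.snd.comp ((ht d).comp (computable_dyadic.comp
      (Primrec.nat_add.comp Primrec.id (Primrec.const 3)).to_comp))) (l + 2)
  have hclose : ∀ d k u x, Q u ∈ interior (Set.range (D.digit d)) →
      x ∈ interior (Set.range (D.digit d)) → dist x (Q u) < (1 / 2 : ℝ) ^ om k →
      dist (sec d x) (fun j => Q (v d (dyadic (k + 3)) u j)) ≤ (1 / 2 : ℝ) ^ (k + 2) := by
    intro d k u x hu hx hxu
    have := hsec' d x hx (dyadic (k + 3)) u hu (hxu.trans_le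
      ((half_pow_anti (homt d k)).trans (half_pow_le_posRat _)))
    rw [posRat_dyadic, half_pow_succ] at this
    linarith
  have hchoice : ∃ c : Fin D.size → ℕ × ℕ → List ℕ, Computable₂ c ∧
      (∀ d p, (c d p).length = D.ar d) ∧
      ∀ d k u, Metric.ball (Q u) ((1 / 2 : ℝ) ^ (l + 1)) ⊆ Set.range (D.digit d) →
        c d (k, u) = List.ofFn (v d (dyadic (k + 3)) u) := by
    -- The given procedure need not halt outside the interior of the range. The decidable ball test
    -- guards it, and a dummy tuple makes the result total.
    refine ⟨fun d p => if Metric.ball (Q p.2) ((1 / 2 : ℝ) ^ (l + 1)) ⊆ Set.range (D.digit d)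
      then List.ofFn (v d (dyadic (p.1 + 3)) p.2) else List.ofFn fun _ : Fin (D.ar d) => 0,
      computable_fin_cases fun d => ?_, fun d p => ?_, fun d k u hu => if_pos hu⟩
    · obtain ⟨i, hi⟩ := hdec' (l + 1)
      have htest : Computable fun p : ℕ × ℕ => @decide _ (i (p.2, d)) :=
        hi.comp (Computable.snd.pair (Computable.const d))
      have hrun : Partrec fun p' : ℕ × ℕ => p d (dyadic (p'.1 + 3), p'.2) :=
        (hp d).comp ((computable_dyadic.comp ((Primrec.nat_add.comp Primrec.fst
          (Primrec.const 3)).to_comp)).pair Computable.snd)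
      have hrun' : Partrec fun p' : ℕ × ℕ => (p d (dyadic (p'.1 + 3), p'.2)).map
          fun w => List.ofFn w :=
        hrun.map ((computable_ofFn _).comp Computable.snd).to₂
      have hconst : Partrec fun _ : ℕ × ℕ => Part.some (List.ofFn fun _ : Fin (D.ar d) => 0) :=
        Computable.const _
      refine Partrec.of_eq_tot (Partrec.cond htest hrun' hconst) fun q => ?_
      by_cases hq : Metric.ball (Q q.2) ((1 / 2 : ℝ) ^ (l + 1)) ⊆ Set.range (D.digit d)
      · simp only [hq, decide_true, cond_true, if_true]
        exact Part.mem_map _ (hvp d _ _ (ball_subset_interior hq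
          (Metric.mem_ball_self (half_pow_pos _))))
      · simp only [hq, decide_false, cond_false, if_false]
        exact Part.mem_some _
    · dsimp only
      split_ifs <;> simp
  obtain ⟨c, hc, hcl, hc'⟩ := hchoice
  choose hmod A hA hA' using fun d => (isComputableMap_iff.1 (h.computable_digit d))
  exact ⟨{
    dense := hdense
    K := K
    K_nonneg := hK0
    K_lt_one := hK1
    dist_digit := hK
    B := B
    dist_le := fun x y => hB (Set.mem_univ x) (Set.mem_univ y)
    depth := N
    computable_depth := hN
    depth_spec := hN'
    leb := l
    sel := sel
    computable_sel := hsel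
    ball_sel := hsel'
    sec := sec
    digit_sec := hsec
    om := om
    computable_om := hom
    le_om := hle
    leb_le_om := hlel
    dist_sec := fun d k x x' hx hx' hxx => by
      have hopen : IsOpen (interior (Set.range (D.digit d))) := isOpen_interior
      obtain ⟨ε, hε, hball⟩ := Metric.isOpen_iff.1 hopen x hx
      -- The common reference point has to lie in the interior and within `2 ^ (-om k)` of both `x`
      -- and `x'`; the slack in `hxx` leaves room for the latter.
      obtain ⟨u, hu⟩ := hdense.exists_dist_lt x (lt_min hε (sub_pos.2 hxx))
      have hu1 := hu.trans_le (min_le_left _ _)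
      have hu2 := hu.trans_le (min_le_right _ _)
      have huint : Q u ∈ interior (Set.range (D.digit d)) := hball <| by
        rwa [Metric.mem_ball, dist_comm]
      have a1 := hclose d k u x huint hx (by
        have := dist_nonneg (x := x) (y := x'); linarith)
      have a2 := hclose d k u x' huint hx' (by
        have := dist_triangle x' x (Q u)
        rw [dist_comm x' x] at this
        linarith)
      have a3 := dist_triangle_right (sec d x) (sec d x')
        (fun j => Q (v d (dyadic (k + 3)) u j))
      have a4 := half_pow_succ (k + 1)
      have a5 := half_pow_succ k
      have a6 := half_pow_pos k
      linarith
    choice := c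
    computable_choice := hc
    length_choice := hcl
    choice_spec := fun d k u hu x hx hxu => by
      rw [hc' d k u hu, tuple_ofFn]
      refine (hclose d k u x (ball_subset_interior hu
        (Metric.mem_ball_self (half_pow_pos _))) hx hxu).trans_lt ?_
      have a4 := half_pow_succ (k + 1)
      have a5 := half_pow_succ k
      have a6 := half_pow_pos k
      linarith
    appr := fun d p => A d p.1 p.2
    computable_appr := computable_fin_cases fun d => hA d
    appr_spec := fun d l k hl => hA' d l k hl }⟩

end Effective

/-! ### Replacing an entry by a block -/

/-- Replace the entry at position `i` by the entries of `v`. -/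
def plugList {α : Type*} (l : List α) (i : ℕ) (v : List α) : List α :=
  l.take i ++ (v ++ l.drop (i + 1))

theorem length_plugList {α : Type*} {l v : List α} {i : ℕ} (h : i < l.length) :
    (plugList l i v).length = v.length + l.length - 1 := by
  simp only [plugList, List.length_append, List.length_take, List.length_drop]
  omega

theorem getD_plugList {α : Type*} {l v : List α} {i : ℕ} (h : i < l.length) (j : ℕ) (a : α) :
    (plugList l i v).getD j a = if j < i then l.getD j a
      else if j < i + v.length then v.getD (j - i) a else l.getD (j + 1 - v.length) a := by
  have ht : (l.take i).length = i := by simp; omega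
  split_ifs with h1 h2
  · rw [plugList, List.getD_append _ _ _ _ (by omega)]
    simp [List.getD_eq_getElem?_getD, h1]
  · rw [plugList, List.getD_append_right _ _ _ _ (by omega), ht, List.getD_append _ _ _ _ (by omega)]
  · rw [plugList, List.getD_append_right _ _ _ _ (by omega), ht,
      List.getD_append_right _ _ _ _ (by omega)]
    simp only [List.getD_eq_getElem?_getD, List.getElem?_drop]
    congr 2
    omega

theorem primrec_plugList {α : Type*} [Primcodable α] :
    Primrec fun p : List α × ℕ × List α => plugList p.1 p.2.1 p.2.2 :=
  Primrec.list_append.comp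
    (Primrec.list_take.comp (Primrec.fst.comp Primrec.snd) Primrec.fst)
    (Primrec.list_append.comp (Primrec.snd.comp Primrec.snd)
      (Primrec.list_drop.comp (Primrec.succ.comp (Primrec.fst.comp Primrec.snd)) Primrec.fst))

/-- Replace the entry at position `i` of a tuple by the entries of `y`. -/
def unplug {X : Type*} {n m : ℕ} (x : Fin m → X) (i : Fin m) (y : Fin n → X) :
    Fin (n + m - 1) → X := fun j =>
  if h₁ : (j : ℕ) < i then x ⟨j, by omega⟩
  else if h₂ : (j : ℕ) < i + n then y ⟨j - i, by omega⟩
  else x ⟨j + 1 - n, by omega⟩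

/-- This evaluates a map at `x` through its composition with a digit: `x i` is exchanged for a
preimage, which the digit then undoes. -/
theorem plug_unplug {X : Type*} {n m : ℕ} (φ : (Fin n → X) → X) (x : Fin m → X) (i : Fin m)
    (y : Fin n → X) (h : φ y = x i) : plug φ i (unplug x i y) = x := by
  funext j
  rcases lt_trichotomy (j : ℕ) i with h1 | h1 | h1
  · simp [plug, unplug, h1]
  · obtain rfl : j = i := Fin.ext h1
    simp [plug, unplug, h]
  · have e1 : ¬ (j : ℕ) < i := by omega
    have e2 : ¬ (j : ℕ) = i := by omega
    have e3 : ¬ (j : ℕ) + n - 1 < i := by omega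
    have e4 : ¬ (j : ℕ) + n - 1 < i + n := by omega
    have e5 : (j : ℕ) + n - 1 + 1 - n = j := by omega
    simp [plug, unplug, e1, e2, e3, e4, e5]

theorem dist_unplug_lt {X : Type*} [MetricSpace X] {n m : ℕ} {x x' : Fin m → X} (i : Fin m)
    {y y' : Fin n → X} {r : ℝ} (hr : 0 < r) (hx : dist x x' < r) (hy : dist y y' < r) :
    dist (unplug x i y) (unplug x' i y') < r := by
  rw [dist_pi_lt_iff hr] at hx hy ⊢
  intro j
  unfold unplug
  split_ifs
  exacts [hx _, hy _, hx _]

theorem tuple_plugList {X : Type*} (Q : ℕ → X) {l v : List ℕ} {n m : ℕ} (hl : l.length = m)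
    (hv : v.length = n) (i : Fin m) :
    tuple Q (plugList l i v) (n + m - 1) = unplug (tuple Q l m) i (tuple Q v n) := by
  funext j
  have hi : (i : ℕ) < l.length := hl ▸ i.2
  simp only [tuple, unplug, getD_plugList hi, hv]
  split_ifs <;> rfl

/-! ### From realisers to algorithms -/

section Soundness

variable {X : Type*} [MetricSpace X] {Y : Type*} [MetricSpace Y]
  {D : ExtendedIFS X} {E : ExtendedIFS Y}

/-- The index of the argument read at a node. -/
def readIndex (o : Option (Label E)) : Option ℕ := o.bind (Sum.elim (fun _ => none) some)

/-- The number of immediate subtrees. -/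
def branching (D : ExtendedIFS X) (o : Option (Label E)) : ℕ := (o.map (labelAr D E)).getD 0

theorem computable_readIndex : Computable (readIndex (E := E)) := by
  have h : Computable fun a : Label E => (Sum.elim (fun _ => none) some a : Option ℕ) :=
    (Computable.sumCasesOn (f := fun a : Label E => a) (g := fun _ _ => (none : Option ℕ))
      (h := fun _ i => some i) Computable.id (Computable.const none).to₂
      (Computable.option_some.comp Computable.snd).to₂).of_eq fun a => by cases a <;> rfl
  exact Computable.option_bind Computable.id (h.comp Computable.snd).to₂

theorem computable_branching : Computable (branching (E := E) D) := by
  have h : Computable fun a : Label E => labelAr D E a :=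
    (Computable.sumCasesOn (f := fun a : Label E => a) (g := fun _ e => E.ar e)
      (h := fun _ _ => D.size) Computable.id
      ((Primrec.dom_finite E.ar).to_comp.comp Computable.snd).to₂
      (Computable.const D.size).to₂).of_eq fun a => by cases a <;> rfl
  exact Computable.option_getD (Computable.option_map Computable.id (h.comp Computable.snd).to₂)
    (Computable.const 0)

/-- The maximum of a list of natural numbers. -/
def listMax (l : List ℕ) : ℕ := l.foldr max 0

theorem le_listMax {l : List ℕ} {a : ℕ} (h : a ∈ l) : a ≤ listMax l := by
  induction l with
  | nil => simp at h
  | cons b l ih =>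
    rcases List.mem_cons.1 h with rfl | h
    · exact le_max_left _ _
    · exact (ih h).trans (le_max_right _ _)

theorem primrec_listMax : Primrec listMax :=
  Primrec.list_foldr Primrec.id (Primrec.const 0)
    (Primrec.nat_max.comp (Primrec.fst.comp Primrec.snd) (Primrec.snd.comp Primrec.snd)).to₂

theorem forall₂_map_range {α σ : Type*} {R : α → σ → Prop} {n : ℕ} {f : ℕ → α} {g : ℕ → σ}
    (h : ∀ j < n, R (f j) (g j)) :
    List.Forall₂ R ((List.range n).map f) ((List.range n).map g) := by
  rw [List.forall₂_map_left_iff, List.forall₂_map_right_iff, List.forall₂_same]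
  exact fun j hj => h j (List.mem_range.1 hj)

/-- The calls for the modulus at a node: all immediate subtrees, with a smaller number of writing
nodes to be passed if the node is a writing node. -/
def modulusCalls (D : ExtendedIFS X) (L : List ℕ → Option (Label E)) (p : List ℕ × ℕ) :
    List (List ℕ × ℕ) :=
  (List.range (if p.2 = 0 then 0 else branching D (L p.1))).map fun j =>
    (p.1 ++ [j], if (readIndex (L p.1)).isSome then p.2 else p.2 - 1)

theorem computable_modulusCalls {L : List ℕ → Option (Label E)} (hL : Computable L) :
    Computable (modulusCalls D L) := by
  have h1 : Primrec fun q : (List ℕ × ℕ) × (ℕ × Bool) =>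
      (List.range (if q.1.2 = 0 then 0 else q.2.1)).map fun j =>
        (q.1.1 ++ [j], if q.2.2 = true then q.1.2 else q.1.2 - 1) := by
    refine Primrec.list_map (Primrec.list_range.comp (Primrec.ite
      (Primrec.eq.comp (Primrec.snd.comp Primrec.fst) (Primrec.const 0)) (Primrec.const 0)
      (Primrec.fst.comp Primrec.snd))) (Primrec.pair ?_ (Primrec.ite ?_ ?_ ?_))
    · exact Primrec.list_concat.comp (Primrec.fst.comp (Primrec.fst.comp Primrec.fst)) Primrec.snd
    · exact Primrec.eq.comp (Primrec.snd.comp (Primrec.snd.comp Primrec.fst)) (Primrec.const true)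
    · exact Primrec.snd.comp (Primrec.fst.comp Primrec.fst)
    · exact Primrec.pred.comp (Primrec.snd.comp (Primrec.fst.comp Primrec.fst))
  have h2 : Computable fun p : List ℕ × ℕ => L p.1 := hL.comp Computable.fst
  have h3 := h1.to_comp.comp (Computable.id.pair ((computable_branching (D := D).comp h2).pair
    (Primrec.option_isSome.to_comp.comp (computable_readIndex.comp h2))))
  exact h3

/-- The modulus at a node from the moduli of the immediate subtrees. The second component is the
value of `om` at the first one. -/
def modulusCombine (L : List ℕ → Option (Label E)) (om : ℕ → ℕ) (p : List ℕ × ℕ)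
    (r : List (ℕ × ℕ)) : ℕ × ℕ :=
  (fun k => (k, om k))
    (listMax (r.map fun v => if (readIndex (L p.1)).isSome then v.2 else v.1))

theorem computable_modulusCombine {L : List ℕ → Option (Label E)} (hL : Computable L)
    {om : ℕ → ℕ} (hom : Computable om) : Computable₂ (modulusCombine L om) := by
  -- As the values of `om` are stored with the moduli, the map over the list is primitive recursive,
  -- and `om` is applied only once, to the maximum.
  have h1 : Primrec fun q : Bool × List (ℕ × ℕ) =>
      listMax (q.2.map fun v => if q.1 = true then v.2 else v.1) := by
    refine primrec_listMax.comp (Primrec.list_map Primrec.snd (Primrec.ite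
      (Primrec.eq.comp (Primrec.fst.comp Primrec.fst) (Primrec.const true))
      (Primrec.snd.comp Primrec.snd) (Primrec.fst.comp Primrec.snd)))
  have h2 : Computable fun p : (List ℕ × ℕ) × List (ℕ × ℕ) => L p.1.1 :=
    hL.comp (Computable.fst.comp Computable.fst)
  have h3 := h1.to_comp.comp ((Primrec.option_isSome.to_comp.comp
    (computable_readIndex.comp h2)).pair Computable.snd)
  have h4 : Computable fun k => (k, om k) := Computable.id.pair hom
  exact h4.comp h3

/-- The node whose modulus is needed for the evaluation at a node. -/
def evalTarget (L : List ℕ → Option (Label E)) (sel : ℕ → Fin D.size)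
    (p : (List ℕ × ℕ) × (List ℕ × ℕ)) : List ℕ × ℕ :=
  Option.casesOn (readIndex (L p.1.1)) p.1 fun i => (p.1.1 ++ [(sel (p.2.1.getD i 0) : ℕ)], p.1.2)

theorem computable_evalTarget {L : List ℕ → Option (Label E)} (hL : Computable L)
    {sel : ℕ → Fin D.size} (hsel : Computable sel) : Computable (evalTarget L sel) := by
  have h2 : Computable fun p : (List ℕ × ℕ) × (List ℕ × ℕ) => readIndex (L p.1.1) :=
    computable_readIndex.comp (hL.comp (Computable.fst.comp Computable.fst))
  have h3 : Computable fun q : ((List ℕ × ℕ) × (List ℕ × ℕ)) × ℕ => q.1.2.1.getD q.2 0 :=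
    (Primrec.list_getD 0).to_comp.comp (Computable.fst.comp (Computable.snd.comp Computable.fst))
      Computable.snd
  have h4 : Computable fun q : ((List ℕ × ℕ) × (List ℕ × ℕ)) × ℕ =>
      ((sel (q.1.2.1.getD q.2 0) : Fin D.size) : ℕ) := Primrec.fin_val.to_comp.comp (hsel.comp h3)
  have h5 : Computable fun q : ((List ℕ × ℕ) × (List ℕ × ℕ)) × ℕ =>
      (q.1.1.1 ++ [((sel (q.1.2.1.getD q.2 0) : Fin D.size) : ℕ)], q.1.1.2) :=
    (Computable.list_concat.comp (Computable.fst.comp (Computable.fst.comp Computable.fst)) h4).pair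
      (Computable.snd.comp (Computable.fst.comp Computable.fst))
  exact Computable.option_casesOn h2 Computable.fst h5.to₂

/-- The calls for the evaluation at a node, given the modulus of the target node. -/
def evalCalls (D : ExtendedIFS X) (L : List ℕ → Option (Label E)) (sel : ℕ → Fin D.size)
    (choice : Fin D.size → ℕ × ℕ → List ℕ) (p : (List ℕ × ℕ) × (List ℕ × ℕ)) (k : ℕ × ℕ) :
    List ((List ℕ × ℕ) × (List ℕ × ℕ)) :=
  if p.1.2 = 0 then [] else
    Option.casesOn (readIndex (L p.1.1))
      ((List.range (branching D (L p.1.1))).map fun j => ((p.1.1 ++ [j], p.1.2 - 1), p.2))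
      fun i => [(evalTarget L sel p, (plugList p.2.1 i
        (choice (sel (p.2.1.getD i 0)) (k.1, p.2.1.getD i 0)), p.2.2))]

theorem computable_evalCalls {L : List ℕ → Option (Label E)} (hL : Computable L)
    {sel : ℕ → Fin D.size} (hsel : Computable sel) {choice : Fin D.size → ℕ × ℕ → List ℕ}
    (hchoice : Computable₂ choice) : Computable₂ (evalCalls D L sel choice) := by
  have hL' : Computable fun p : ((List ℕ × ℕ) × (List ℕ × ℕ)) × (ℕ × ℕ) => L p.1.1.1 :=
    hL.comp (Computable.fst.comp (Computable.fst.comp Computable.fst))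
  have h1 : Primrec fun q : ((List ℕ × ℕ) × (List ℕ × ℕ)) × ℕ =>
      (List.range q.2).map fun j => ((q.1.1.1 ++ [j], q.1.1.2 - 1), q.1.2) := by
    refine Primrec.list_map (Primrec.list_range.comp Primrec.snd) (Primrec.pair (Primrec.pair ?_ ?_)
      (Primrec.snd.comp (Primrec.fst.comp Primrec.fst)))
    · exact Primrec.list_concat.comp
        (Primrec.fst.comp (Primrec.fst.comp (Primrec.fst.comp Primrec.fst))) Primrec.snd
    · exact Primrec.pred.comp (Primrec.snd.comp (Primrec.fst.comp (Primrec.fst.comp Primrec.fst)))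
  have h2 := h1.to_comp.comp (Computable.fst.pair (computable_branching (D := D).comp hL'))
  have hl : Computable fun q : (((List ℕ × ℕ) × (List ℕ × ℕ)) × (ℕ × ℕ)) × ℕ => q.1.1.2.1 :=
    Computable.fst.comp (Computable.snd.comp (Computable.fst.comp Computable.fst))
  have hu : Computable fun q : (((List ℕ × ℕ) × (List ℕ × ℕ)) × (ℕ × ℕ)) × ℕ =>
      q.1.1.2.1.getD q.2 0 := (Primrec.list_getD 0).to_comp.comp hl Computable.snd
  have hk : Computable fun q : (((List ℕ × ℕ) × (List ℕ × ℕ)) × (ℕ × ℕ)) × ℕ => q.1.2.1 :=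
    Computable.fst.comp (Computable.snd.comp Computable.fst)
  have h3 : Computable fun q : (((List ℕ × ℕ) × (List ℕ × ℕ)) × (ℕ × ℕ)) × ℕ =>
      choice (sel (q.1.1.2.1.getD q.2 0)) (q.1.2.1, q.1.1.2.1.getD q.2 0) :=
    hchoice.comp (hsel.comp hu) (hk.pair hu)
  have h4 := primrec_plugList.to_comp.comp (hl.pair (Computable.snd.pair h3))
  have h5 := ((computable_evalTarget hL hsel).comp
    (Computable.fst.comp (Computable.fst (α := ((List ℕ × ℕ) × (List ℕ × ℕ)) × (ℕ × ℕ))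
      (β := ℕ)))).pair (h4.pair (Computable.snd.comp
        (Computable.snd.comp (Computable.fst.comp Computable.fst))))
  have h6 := Computable.list_cons.comp h5 (Computable.const [])
  have h7 := Computable.option_casesOn (computable_readIndex.comp hL') h2 h6.to₂
  have h8 : Computable fun p : ((List ℕ × ℕ) × (List ℕ × ℕ)) × (ℕ × ℕ) => decide (p.1.1.2 = 0) :=
    (Primrec.eq.decide.comp (Primrec.snd.comp (Primrec.fst.comp Primrec.fst))
      (Primrec.const 0)).to_comp
  refine (Computable.cond h8 (Computable.const []) h7).of_eq fun p => ?_
  rw [Bool.cond_decide]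
  rfl

/-- The value at a node from the results of the calls. -/
def evalCombine (L : List ℕ → Option (Label E)) (appr : Fin E.size → List ℕ × ℕ → ℕ)
    (p : (List ℕ × ℕ) × (List ℕ × ℕ)) (r : List ℕ) : ℕ :=
  Option.casesOn (L p.1.1) 0 fun a =>
    Sum.casesOn a (fun e => appr e (r, p.2.2)) fun _ => r.getD 0 0

theorem computable_evalCombine {L : List ℕ → Option (Label E)} (hL : Computable L)
    {appr : Fin E.size → List ℕ × ℕ → ℕ} (happr : Computable₂ appr) :
    Computable₂ (evalCombine L appr) := by
  have hL' : Computable fun p : ((List ℕ × ℕ) × (List ℕ × ℕ)) × List ℕ => L p.1.1.1 :=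
    hL.comp (Computable.fst.comp (Computable.fst.comp Computable.fst))
  have h1 : Computable fun q : ((((List ℕ × ℕ) × (List ℕ × ℕ)) × List ℕ) × Label E) ×
      Fin E.size => appr q.2 (q.1.1.2, q.1.1.1.2.2) :=
    happr.comp Computable.snd ((Computable.snd.comp (Computable.fst.comp Computable.fst)).pair
      (Computable.snd.comp (Computable.snd.comp (Computable.fst.comp
        (Computable.fst.comp Computable.fst)))))
  have h2 : Computable fun q : ((((List ℕ × ℕ) × (List ℕ × ℕ)) × List ℕ) × Label E) × ℕ =>
      q.1.1.2.getD 0 0 :=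
    (Primrec.list_getD 0).to_comp.comp (Computable.snd.comp (Computable.fst.comp Computable.fst))
      (Computable.const 0)
  have h3 := Computable.sumCasesOn (f := fun q : (((List ℕ × ℕ) × (List ℕ × ℕ)) × List ℕ) ×
    Label E => q.2) Computable.snd h1.to₂ h2.to₂
  have h4 := Computable.option_casesOn hL' (Computable.const 0) h3.to₂
  exact h4

theorem LTree.label_nil_eq {A : Type*} {ar : A → ℕ} {T : LTree A ar} {a : A} (h : T.root = a) :
    T.label [] = some a := by
  rw [← h]; exact (Option.some_get T.root_isSome).symm

end Soundness

section Soundness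

variable {X : Type*} [MetricSpace X] {Y : Type*} [MetricSpace Y]
  {D : ExtendedIFS X} {E : ExtendedIFS Y}

/-- The computations at a node of a realiser terminate, and yield approximations. -/
theorem eval_realiser_spec {QX : ℕ → X} {QY : ℕ → Y} (dX : EffectiveData D QX)
    (dY : EffectiveData E QY) {L : List ℕ → Option (Label E)}
    {M : List ℕ × ℕ →. ℕ × ℕ} {V : (List ℕ × ℕ) × (List ℕ × ℕ) →. ℕ}
    (hM : ∀ p r, List.Forall₂ (fun a v => v ∈ M a) (modulusCalls D L p) r →
      modulusCombine L dX.om p r ∈ M p)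
    (hV : ∀ p k r, k ∈ M (evalTarget L dX.sel p) →
      List.Forall₂ (fun a v => v ∈ V a) (evalCalls D L dX.sel dX.choice p k) r →
      evalCombine L dY.appr p r ∈ V p)
    (n : ℕ) {T : FTree D E} {f : Maps X Y} (hT : Realises D E T f) :
    ∀ s, (∀ r, T.label r = L (s ++ r)) → ∃ k, (k, dX.om k) ∈ M (s, n) ∧
      ∀ l N, l.length = f.1 → ∃ v ∈ V ((s, n), (l, N)), ∀ x,
        dist x (tuple QX l f.1) < (1 / 2 : ℝ) ^ k →
        dist (f.2 x) (QY v) ≤ dY.K ^ n * dY.B + (1 - dY.K)⁻¹ * (1 / 2 : ℝ) ^ N := by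
  have hK0 := dY.K_nonneg
  have hK1 : 0 < 1 - dY.K := sub_pos.2 dY.K_lt_one
  have hC : 0 < (1 - dY.K)⁻¹ := inv_pos.2 hK1
  refine Realises.write_induction (P := fun n T f => ∀ s, (∀ r, T.label r = L (s ++ r)) →
    ∃ k, (k, dX.om k) ∈ M (s, n) ∧ ∀ l N, l.length = f.1 → ∃ v ∈ V ((s, n), (l, N)), ∀ x,
      dist x (tuple QX l f.1) < (1 / 2 : ℝ) ^ k →
      dist (f.2 x) (QY v) ≤ dY.K ^ n * dY.B + (1 - dY.K)⁻¹ * (1 / 2 : ℝ) ^ N) ?_ ?_ ?_ n hT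
  · intro T f s _
    -- With no writing node left to pass there are no calls, and any value will do because `dY.B`
    -- bounds all distances.
    have hM0 : ∀ s, (0, dX.om 0) ∈ M (s, 0) := fun s =>
      hM (s, 0) [] (by simp [modulusCalls])
    refine ⟨0, hM0 s, fun l N _ => ⟨_, hV ((s, 0), (l, N)) (0, dX.om 0) [] ?_ ?_, fun x _ => ?_⟩⟩
    · unfold evalTarget
      cases readIndex (L s) <;> exact hM0 _
    · simp [evalCalls]
    · have h1 := dY.dist_le (f.2 x) (QY (evalCombine L dY.appr ((s, 0), (l, N)) []))
      have h2 : 0 < (1 - dY.K)⁻¹ * (1 / 2 : ℝ) ^ N := mul_pos hC (half_pow_pos N)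
      simp only [pow_zero, one_mul]
      linarith
  · intro n T f e he g ih hf s hs
    have hLs : L s = some (Sum.inl e) := by
      rw [← LTree.label_nil_eq he, hs, List.append_nil]
    have ih' : ∀ j, ∃ k, ∀ hj : j < E.ar e, (k, dX.om k) ∈ M (s ++ [j], n) ∧
        ∀ l N, l.length = f.1 → ∃ v ∈ V ((s ++ [j], n), (l, N)), ∀ x,
          dist x (tuple QX l f.1) < (1 / 2 : ℝ) ^ k →
          dist (g ⟨j, hj⟩ x) (QY v) ≤
            dY.K ^ n * dY.B + (1 - dY.K)⁻¹ * (1 / 2 : ℝ) ^ N := by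
      intro j
      by_cases hj : j < E.ar e
      · obtain ⟨k, hk⟩ := ih ⟨j, hj⟩ (s ++ [j]) fun r => by
          rw [List.append_assoc]; exact hs (j :: r)
        exact ⟨k, fun _ => hk⟩
      · exact ⟨0, fun h => absurd h hj⟩
    choose k hk using ih'
    have hM' := hM (s, n + 1) ((List.range (E.ar e)).map fun j => (k j, dX.om (k j))) (by
      simp only [modulusCalls, hLs, readIndex, branching, labelAr]
      exact forall₂_map_range fun j hj => (hk j hj).1)
    simp only [modulusCombine, hLs, readIndex, List.map_map] at hM'
    refine ⟨_, hM', fun l N hl => ?_⟩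
    have hv' : ∀ j, ∃ v, ∀ hj : j < E.ar e, v ∈ V ((s ++ [j], n), (l, N)) ∧ ∀ x,
          dist x (tuple QX l f.1) < (1 / 2 : ℝ) ^ k j →
          dist (g ⟨j, hj⟩ x) (QY v) ≤
            dY.K ^ n * dY.B + (1 - dY.K)⁻¹ * (1 / 2 : ℝ) ^ N := by
      intro j
      by_cases hj : j < E.ar e
      · obtain ⟨v, hv⟩ := (hk j hj).2 l N hl
        exact ⟨v, fun _ => hv⟩
      · exact ⟨0, fun h => absurd h hj⟩
    choose v hv using hv'
    -- At a writing node the target is the node itself. Its modulus is ignored by the calls, but its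
    -- computation must terminate.
    have hV' := hV ((s, n + 1), (l, N)) _ ((List.range (E.ar e)).map v) (by
      simp only [evalTarget, hLs, readIndex]
      exact hM') (by
      simp only [evalCalls, hLs, readIndex, branching, labelAr]
      exact forall₂_map_range fun j hj => (hv j hj).1)
    simp only [evalCombine, hLs] at hV'
    refine ⟨_, hV', fun x hx => ?_⟩
    have h1 := dY.appr_spec e ((List.range (E.ar e)).map v) N (by simp)
    have h2 := dY.dist_digit e (fun k => g k x) (tuple QY ((List.range (E.ar e)).map v) (E.ar e))
    have h3 : dist (fun k => g k x) (tuple QY ((List.range (E.ar e)).map v) (E.ar e)) ≤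
        dY.K ^ n * dY.B + (1 - dY.K)⁻¹ * (1 / 2 : ℝ) ^ N := by
      have : Nonempty (Fin (E.ar e)) := ⟨⟨0, E.ar_pos e⟩⟩
      refine dist_pi_le_iff'.2 fun j => ?_
      have := (hv j j.2).2 x (hx.trans_le (half_pow_anti (le_listMax
        (List.mem_map.2 ⟨(j : ℕ), List.mem_range.2 j.2, rfl⟩))))
      simpa [tuple] using this
    rw [hf]
    calc dist (E.digit e fun k => g k x) (QY _)
        ≤ dist (E.digit e fun k => g k x)
            (E.digit e (tuple QY ((List.range (E.ar e)).map v) (E.ar e))) + _ :=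
          dist_triangle _ _ _
      -- The constant `(1 - K)⁻¹` is the sum of the geometric series of rounding errors: it solves
      -- `K * C + 1 = C`.
      _ ≤ dY.K * (dY.K ^ n * dY.B + (1 - dY.K)⁻¹ * (1 / 2 : ℝ) ^ N) + (1 / 2 : ℝ) ^ N :=
          add_le_add (h2.trans (mul_le_mul_of_nonneg_left h3 hK0)) h1.le
      _ = _ := by
          have := hK1.ne'
          field_simp
          ring
  · intro n T f i hi ih s hs
    have hLs : L s = some (Sum.inr (i : ℕ)) := by
      rw [← LTree.label_nil_eq hi, hs, List.append_nil]
    choose k hkM hkV using fun d : Fin D.size => ih d (s ++ [(d : ℕ)]) fun r => by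
      rw [List.append_assoc]; exact hs (d :: r)
    let k' : ℕ → ℕ := fun j => if h : j < D.size then k ⟨j, h⟩ else 0
    have hk' : ∀ d : Fin D.size, k' d = k d := fun d => by simp [k']
    have hM' := hM (s, n + 1) ((List.range D.size).map fun j => (k' j, dX.om (k' j))) (by
      simp only [modulusCalls, hLs, readIndex, branching, labelAr]
      refine forall₂_map_range fun j hj => ?_
      have := hkM ⟨j, hj⟩
      rw [← hk'] at this
      exact this)
    simp only [modulusCombine, hLs, readIndex, List.map_map] at hM'
    refine ⟨_, hM', fun l N hl => ?_⟩
    set u := l.getD i 0 with hu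
    set d := dX.sel u with hd
    have hil : (i : ℕ) < l.length := by rw [hl]; exact i.2
    have hlen := dX.length_choice d (k d, u)
    obtain ⟨v, hvV, hv⟩ := hkV d (plugList l i (dX.choice d (k d, u))) N (by
      rw [length_plugList hil, hlen, hl])
    have hV' := hV ((s, n + 1), (l, N)) (k d, dX.om (k d)) [v] (by
      simp only [evalTarget, hLs, readIndex]
      exact hkM d) (by
      simp only [evalCalls, evalTarget, hLs, readIndex]
      exact List.Forall₂.cons hvV List.Forall₂.nil)
    simp only [evalCombine, hLs] at hV'
    refine ⟨_, hV', fun x hx => ?_⟩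
    -- The digit `d` depends only on the basic approximation `u`. The modulus at a reading node is
    -- at least `om (k d)`, which puts `x i` into the Lebesgue ball around `u` for every admissible
    -- `x`.
    have hx' : dist x (tuple QX l f.1) < (1 / 2 : ℝ) ^ dX.om (k d) := by
      refine hx.trans_le (half_pow_anti (le_listMax
        (List.mem_map.2 ⟨(d : ℕ), List.mem_range.2 d.2, ?_⟩)))
      exact congrArg dX.om (hk' d)
    have hball := dX.ball_sel u
    have hxi : dist (x i) (QX u) < (1 / 2 : ℝ) ^ dX.om (k d) :=
      (dist_le_pi_dist x (tuple QX l f.1) i).trans_lt hx'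
    have hint : x i ∈ interior (Set.range (D.digit d)) :=
      ball_subset_interior hball (Metric.mem_ball.2 (hxi.trans_le
        (half_pow_anti (le_trans (by omega) (dX.leb_le_om (k d))))))
    have hsec := dX.choice_spec d (k d) u ((Metric.ball_subset_ball
      (half_pow_anti (Nat.le_succ _))).trans hball) (x i) hint hxi
    have := hv (unplug x i (dX.sec d (x i))) (by
      rw [tuple_plugList QX hl hlen]
      exact dist_unplug_lt i (half_pow_pos _)
        (hx'.trans_le (half_pow_anti (dX.le_om _))) hsec)
    simpa [Function.comp_apply, plug_unplug _ x i _ (dX.digit_sec d (x i) hint)] using this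

/-- A map realised by a computable tree is computable. -/
theorem isComputableMap_of_realises {QX : ℕ → X} {QY : ℕ → Y} (dX : EffectiveData D QX)
    (dY : EffectiveData E QY) {T : FTree D E} (hT : T.IsComputable) {f : Maps X Y}
    (h : Realises D E T f) : IsComputableMap QX QY f.2 := by
  obtain ⟨M, hMp, hM⟩ := exists_partrec_rec (Computable.partrec (computable_modulusCalls (D := D) hT))
    (computable_modulusCombine hT dX.computable_om)
  obtain ⟨V, hVp, hV⟩ := exists_partrec_rec
    (q := fun p => (M (evalTarget T.label dX.sel p)).map
      (evalCalls D T.label dX.sel dX.choice p))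
    (Partrec.map (hMp.comp (computable_evalTarget hT dX.computable_sel))
      (computable_evalCalls hT dX.computable_sel dX.computable_choice))
    (computable_evalCombine hT dY.computable_appr)
  have key := fun n => eval_realiser_spec (QX := QX) (QY := QY) dX dY (L := T.label) (M := M)
    (V := V) (fun p r hr => hM p _ r (Part.mem_some _) hr)
    (fun p k r hk hr => hV p _ r (Part.mem_map _ hk) hr) n h [] fun _ => rfl
  have hK1 : 0 < 1 - dY.K := sub_pos.2 dY.K_lt_one
  -- The extra `c` binary digits absorb the factor `(1 - K)⁻¹`. Truncation and rounding then
  -- contribute at most `2⁻⁽ᵏ⁺²⁾` each.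
  obtain ⟨c, hc⟩ := pow_unbounded_of_one_lt (1 - dY.K)⁻¹ (show (1 : ℝ) < 2 by norm_num)
  have herr : ∀ k, dY.K ^ dY.depth (k + 2) * dY.B +
      (1 - dY.K)⁻¹ * (1 / 2 : ℝ) ^ (k + 2 + c) < (1 / 2 : ℝ) ^ (k + 1) := by
    intro k
    have h1 := dY.depth_spec (k + 2) _ le_rfl
    have h2 : (1 - dY.K)⁻¹ * (1 / 2 : ℝ) ^ (k + 2 + c) ≤ (1 / 2 : ℝ) ^ (k + 2) := by
      calc (1 - dY.K)⁻¹ * (1 / 2 : ℝ) ^ (k + 2 + c)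
          ≤ 2 ^ c * (1 / 2 : ℝ) ^ (k + 2 + c) := by gcongr
        _ = (1 / 2 : ℝ) ^ (k + 2) := by
          rw [pow_add _ (k + 2) c, mul_left_comm, ← mul_pow]; norm_num
    have h3 := half_pow_succ (k + 1)
    linarith
  choose μ hμM hμ using fun k => key (dY.depth (k + 2))
  have hadd : ∀ a : ℕ, Computable fun k : ℕ => k + a := fun a =>
    (Primrec.nat_add.comp Primrec.id (Primrec.const a)).to_comp
  have hdepth : Computable fun k => dY.depth (k + 2) := dY.computable_depth.comp (hadd 2)
  -- The evaluation is known to terminate only on lists of the right length, whereas a total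
  -- function is required; so lists are first cut or padded with `0`.
  let norm : List ℕ → List ℕ := fun l => (List.range f.1).map fun j => l.getD j 0
  have hnorm : Computable norm := (Primrec.list_map (Primrec.const (List.range f.1))
    ((Primrec.list_getD 0).comp Primrec.fst Primrec.snd).to₂).to_comp
  have hnl : ∀ l, (norm l).length = f.1 := fun l => by simp [norm]
  have hnt : ∀ l, tuple QX (norm l) f.1 = tuple QX l f.1 := fun l => by
    funext j; simp [norm, tuple]
  choose v hvV hv using fun (l : List ℕ) (k : ℕ) => hμ k (norm l) (k + 2 + c) (hnl l)
  refine isComputableMap_iff.2 ⟨⟨fun k => μ k + 1, ?_, fun k x y hxy => ?_⟩, v, ?_,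
    fun l k _ => ?_⟩
  · have h1 : Computable fun k => (μ k, dX.om (μ k)) :=
      Partrec.of_eq_tot (hMp.comp ((Computable.const []).pair hdepth)) hμM
    exact Computable.succ.comp (Computable.fst.comp h1)
  -- One basic tuple serves both points: it is within `2 ^ (-(μ k + 1))` of `x`, hence within `2 ^
  -- (-μ k)` of `y`.
  · obtain ⟨l, hl, hxl⟩ := exists_tuple_near dX.dense x (half_pow_pos (μ k + 1))
    have e1 := half_pow_succ (μ k)
    have e2 := half_pow_succ k
    have e3 := dist_triangle_left y (tuple QX l f.1) x
    have e4 := half_pow_pos (μ k)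
    have a1 := hv l k x (by rw [hnt]; linarith)
    have a2 := hv l k y (by rw [hnt]; linarith)
    have a3 := dist_triangle_right (f.2 x) (f.2 y) (QY (v l k))
    have a4 := herr k
    linarith
  · have h1 : Computable fun p : List ℕ × ℕ =>
        (((([] : List ℕ), dY.depth (p.2 + 2)), (norm p.1, p.2 + 2 + c)) :
          (List ℕ × ℕ) × (List ℕ × ℕ)) :=
      ((Computable.const []).pair (hdepth.comp Computable.snd)).pair
        ((hnorm.comp Computable.fst).pair ((hadd c).comp ((hadd 2).comp Computable.snd)))
    exact Partrec.of_eq_tot (hVp.comp h1) fun p => hvV p.1 p.2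
  · have a1 := hv l k (tuple QX l f.1) (by rw [hnt, dist_self]; exact half_pow_pos _)
    have a2 := herr k
    have a3 := half_pow_anti (Nat.le_add_right k 1)
    linarith

end Soundness

/-! ### Collapsing a block of entries -/

/-- Replace the `n` entries starting at position `i` by the single entry `v`. -/
def collapse (l : List ℕ) (i n v : ℕ) : List ℕ := l.take i ++ (v :: l.drop (i + n))

theorem length_collapse {l : List ℕ} {i n m v : ℕ} (hl : l.length = n + m - 1) (hn : 0 < n)
    (hi : i < m) : (collapse l i n v).length = m := by
  simp only [collapse, List.length_append, List.length_take, List.length_cons, List.length_drop]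
  omega

theorem getD_collapse {l : List ℕ} {i n v : ℕ} (hn : 0 < n) (hi : i ≤ l.length) (j : ℕ) :
    (collapse l i n v).getD j 0 =
      if j < i then l.getD j 0 else if j = i then v else l.getD (j + n - 1) 0 := by
  have ht : (l.take i).length = i := by simp; omega
  split_ifs with h1 h2
  · rw [collapse, List.getD_append _ _ _ _ (by omega)]
    simp [List.getD_eq_getElem?_getD, h1]
  · rw [collapse, List.getD_append_right _ _ _ _ (by omega), ht, h2]
    simp
  · rw [collapse, List.getD_append_right _ _ _ _ (by omega), ht]
    obtain ⟨t, rfl⟩ : ∃ t, j = i + 1 + t := ⟨j - (i + 1), by omega⟩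
    have e1 : i + 1 + t - i = t + 1 := by omega
    have e2 : i + 1 + t + n - 1 = i + n + t := by omega
    rw [e1, e2]
    simp [List.getD_eq_getElem?_getD]

theorem dist_plug_collapse_lt {X : Type*} [MetricSpace X] {Q : ℕ → X} {n m : ℕ} (hn : 0 < n)
    (φ : (Fin n → X) → X) (i : Fin m) {l : List ℕ} (hl : l.length = n + m - 1) {v : ℕ} {r : ℝ}
    (hr : 0 < r) (hv : dist (φ (tuple Q ((l.drop i).take n) n)) (Q v) < r) (t : Fin m) :
    dist (plug φ i (tuple Q l (n + m - 1)) t) (tuple Q (collapse l i n v) m t) < r := by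
  have hi : (i : ℕ) ≤ l.length := by omega
  unfold plug
  simp only [tuple, getD_collapse hn hi]
  split_ifs with h1 h2
  · simpa using hr
  · convert hv using 2
    congr 1
    funext k
    simp [tuple, List.getD_eq_getElem?_getD]
  · simpa using hr

section Completeness

variable {X : Type*} [MetricSpace X] {Y : Type*} [MetricSpace Y]
  {D : ExtendedIFS X} {E : ExtendedIFS Y}

/-! ### The algorithms at the nodes of the tree -/

/-- A step in the history of a node: reading argument `i` with the digit `d` after `j` writing
nodes, or passing to the component `k` below a writing node with the digit `e`. -/
abbrev Step (D : ExtendedIFS X) (E : ExtendedIFS Y) := (ℕ × Fin D.size × ℕ) ⊕ (Fin E.size × ℕ)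

/-- A node of the tree: its history, the numbers of times the present arguments have been read,
and the number of writing nodes passed. -/
abbrev State (D : ExtendedIFS X) (E : ExtendedIFS Y) := List (Step D E) × List ℕ × ℕ

variable {QX : ℕ → X} {QY : ℕ → Y} (dX : EffectiveData D QX) (dY : EffectiveData E QY)
  (ζ : ℕ → ℕ) (G : List ℕ → ℕ → ℕ)

/-- The modulus of continuity after `j` writing nodes. -/
def modAfter (j k : ℕ) : ℕ := ζ (dY.om^[j] k)

theorem computable_modAfter {ζ : ℕ → ℕ} (hζ : Computable ζ) : Computable₂ (modAfter dY ζ) := by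
  have h1 : Computable fun p : ℕ × ℕ =>
      Nat.rec (motive := fun _ => ℕ) p.2 (fun _ r => dY.om r) p.1 :=
    Computable.nat_rec Computable.fst Computable.snd
      (dY.computable_om.comp (Computable.snd.comp Computable.snd)).to₂
  refine (hζ.comp h1).of_eq fun p => ?_
  rcases p with ⟨j, k⟩
  refine congrArg ζ ?_
  induction j with
  | zero => rfl
  | succ j ih => rw [Function.iterate_succ_apply']; exact congrArg dY.om ih

/-- The arguments passed on to the previous node. -/
def preStep : Step D E → List ℕ × ℕ → List ℕ × ℕ
  | Sum.inl (i, d, j), (l, k) =>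
    (collapse l i (D.ar d) (dX.appr d ((l.drop i).take (D.ar d), modAfter dY ζ j (k + 1))), k + 1)
  | Sum.inr _, (l, k) => (l, dY.om k)

/-- The value at a node from the value at the previous node. -/
def postStep : Step D E → List ℕ × ℕ → ℕ → ℕ
  | Sum.inl _, _, v => v
  | Sum.inr (e, κ), (_, k), v => (dY.choice e (k, v)).getD κ 0

/-- Approximations of the map belonging to a node. -/
def nodeEval : List (Step D E) → List ℕ × ℕ → ℕ
  | [], a => G a.1 a.2
  | b :: h, a => postStep dY b a (nodeEval h (preStep dX dY ζ b a))

theorem computable_collapse : Computable fun p : (List ℕ × ℕ) × (ℕ × ℕ) =>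
    collapse p.1.1 p.1.2 p.2.1 p.2.2 := by
  have h : Primrec fun p : (List ℕ × ℕ) × (ℕ × ℕ) => collapse p.1.1 p.1.2 p.2.1 p.2.2 := by
    have hi : Primrec fun p : (List ℕ × ℕ) × (ℕ × ℕ) => p.1.2 := Primrec.snd.comp Primrec.fst
    have hl : Primrec fun p : (List ℕ × ℕ) × (ℕ × ℕ) => p.1.1 := Primrec.fst.comp Primrec.fst
    have hn : Primrec fun p : (List ℕ × ℕ) × (ℕ × ℕ) => p.2.1 := Primrec.fst.comp Primrec.snd
    exact Primrec.list_append.comp (Primrec.list_take.comp hi hl)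
      (Primrec.list_cons.comp (Primrec.snd.comp Primrec.snd)
        (Primrec.list_drop.comp (Primrec.nat_add.comp hi hn) hl))
  exact h.to_comp

theorem computable_preStep {ζ : ℕ → ℕ} (hζ : Computable ζ) :
    Computable₂ (preStep dX dY ζ) := by
  have hl : Computable fun q : (Step D E × (List ℕ × ℕ)) × (ℕ × Fin D.size × ℕ) => q.1.2.1 :=
    Computable.fst.comp (Computable.snd.comp Computable.fst)
  have hk : Computable fun q : (Step D E × (List ℕ × ℕ)) × (ℕ × Fin D.size × ℕ) => q.1.2.2 + 1 :=
    Computable.succ.comp (Computable.snd.comp (Computable.snd.comp Computable.fst))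
  have hi : Computable fun q : (Step D E × (List ℕ × ℕ)) × (ℕ × Fin D.size × ℕ) => q.2.1 :=
    Computable.fst.comp Computable.snd
  have hd : Computable fun q : (Step D E × (List ℕ × ℕ)) × (ℕ × Fin D.size × ℕ) => q.2.2.1 :=
    Computable.fst.comp (Computable.snd.comp Computable.snd)
  have hj : Computable fun q : (Step D E × (List ℕ × ℕ)) × (ℕ × Fin D.size × ℕ) => q.2.2.2 :=
    Computable.snd.comp (Computable.snd.comp Computable.snd)
  have har := (Primrec.dom_finite D.ar).to_comp.comp hd
  have h1 := Primrec.list_take.to_comp.comp har (Primrec.list_drop.to_comp.comp hi hl)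
  have h2 := dX.computable_appr.comp hd (h1.pair ((computable_modAfter dY hζ).comp hj hk))
  have h3 := (computable_collapse.comp ((hl.pair hi).pair (har.pair h2))).pair hk
  have h4 : Computable fun q : (Step D E × (List ℕ × ℕ)) × (Fin E.size × ℕ) =>
      (q.1.2.1, dY.om q.1.2.2) :=
    (Computable.fst.comp (Computable.snd.comp Computable.fst)).pair
      (dY.computable_om.comp (Computable.snd.comp (Computable.snd.comp Computable.fst)))
  have h5 := Computable.sumCasesOn (f := fun p : Step D E × (List ℕ × ℕ) => p.1)
    Computable.fst h3.to₂ h4.to₂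
  refine h5.of_eq fun p => ?_
  rcases p with ⟨⟨i, d, j⟩ | ⟨e, κ⟩, l, k⟩ <;> rfl

theorem computable_postStep : Computable fun p : (Step D E × (List ℕ × ℕ)) × ℕ =>
    postStep dY p.1.1 p.1.2 p.2 := by
  have hk : Computable fun q : ((Step D E × (List ℕ × ℕ)) × ℕ) × (Fin E.size × ℕ) =>
      q.1.1.2.2 :=
    Computable.snd.comp (Computable.snd.comp (Computable.fst.comp Computable.fst))
  have hv : Computable fun q : ((Step D E × (List ℕ × ℕ)) × ℕ) × (Fin E.size × ℕ) => q.1.2 :=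
    Computable.snd.comp Computable.fst
  have hv' : Computable fun q : ((Step D E × (List ℕ × ℕ)) × ℕ) × (ℕ × Fin D.size × ℕ) => q.1.2 :=
    Computable.snd.comp Computable.fst
  have he : Computable fun q : ((Step D E × (List ℕ × ℕ)) × ℕ) × (Fin E.size × ℕ) => q.2.1 :=
    Computable.fst.comp Computable.snd
  have hκ : Computable fun q : ((Step D E × (List ℕ × ℕ)) × ℕ) × (Fin E.size × ℕ) => q.2.2 :=
    Computable.snd.comp Computable.snd
  have h1 := (Primrec.list_getD 0).to_comp.comp (dY.computable_choice.comp he (hk.pair hv)) hκ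
  have h2 := Computable.sumCasesOn (f := fun p : (Step D E × (List ℕ × ℕ)) × ℕ => p.1.1)
    (Computable.fst.comp Computable.fst) hv'.to₂ h1.to₂
  refine h2.of_eq fun p => ?_
  rcases p with ⟨⟨⟨i, d, j⟩ | ⟨e, κ⟩, l, k⟩, v⟩ <;> rfl

theorem computable_nodeEval {ζ : ℕ → ℕ} {G : List ℕ → ℕ → ℕ} (hζ : Computable ζ)
    (hG : Computable₂ G) : Computable₂ (nodeEval dX dY ζ G) := by
  have hG' : Computable fun a : List ℕ × ℕ => G a.1 a.2 := hG
  exact computable_list_rec_param hG' (computable_preStep dX dY hζ) (computable_postStep dY)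
    (fun _ => rfl) fun _ _ _ => rfl

/-! ### The transition system -/

/-- The number of times the arguments have to be read before the next writing node. -/
def readDepth (j : ℕ) : ℕ := dX.depth (modAfter dY ζ j (dY.leb + 3))

/-- The label of a node: read the first argument that has not been read often enough; if there is
none, write a digit whose range contains the values of the map. -/
def nodeLabel (σ : State D E) : Label E :=
  if σ.2.1.findIdx (fun a => decide (a < readDepth dX dY ζ σ.2.2)) < σ.2.1.length then
    Sum.inr (σ.2.1.findIdx fun a => decide (a < readDepth dX dY ζ σ.2.2))
  else Sum.inl (dY.sel (nodeEval dX dY ζ G σ.1 (List.replicate σ.2.1.length 0, dY.leb + 3)))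

/-- Numbers as elements of a finite ordinal. -/
def toFin {n : ℕ} (d₀ : Fin n) (c : ℕ) : Fin n := ⟨c % n, Nat.mod_lt _ d₀.pos⟩

theorem toFin_val {n : ℕ} (d₀ d : Fin n) : toFin d₀ d = d := Fin.ext (Nat.mod_eq_of_lt d.2)

theorem computable_toFin {n : ℕ} (d₀ : Fin n) : Computable (toFin d₀) :=
  (Primrec.fin_val_iff.1 (Primrec.nat_mod.comp Primrec.id (Primrec.const n))).to_comp

/-- The read successor of a state. -/
def readChild (σ : State D E) (i : ℕ) (d : Fin D.size) : State D E :=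
  (Sum.inl (i, d, σ.2.2) :: σ.1,
    plugList σ.2.1 i (List.replicate (D.ar d) (σ.2.1.getD i 0 + 1)), σ.2.2)

/-- The write successor of a state. -/
def writeChild (σ : State D E) (e : Fin E.size) (κ : ℕ) : State D E :=
  (Sum.inr (e, κ) :: σ.1, σ.2.1, σ.2.2 + 1)

/-- The immediate successors of a node. -/
def nodeChild (σ : State D E) (c : ℕ) : State D E :=
  Sum.elim (fun e => writeChild σ e c) (fun i => readChild σ i (toFin (dX.sel 0) c))
    (nodeLabel dX dY ζ G σ)

theorem primrec_replicate {α : Type*} [Primcodable α] :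
    Primrec₂ (List.replicate : ℕ → α → List α) :=
  (Primrec.list_map (Primrec.list_range.comp Primrec.fst)
    ((Primrec.snd.comp Primrec.fst).to₂)).of_eq fun p => by simp

theorem computable_nodeLabel {ζ : ℕ → ℕ} {G : List ℕ → ℕ → ℕ} (hζ : Computable ζ)
    (hG : Computable₂ G) : Computable (nodeLabel dX dY ζ G) := by
  have hq : Computable fun σ : State D E => σ.2.1 := Computable.fst.comp Computable.snd
  have hlen : Computable fun σ : State D E => σ.2.1.length := Computable.list_length.comp hq
  have hN : Computable fun σ : State D E => readDepth dX dY ζ σ.2.2 :=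
    dX.computable_depth.comp ((computable_modAfter dY hζ).comp
      (Computable.snd.comp Computable.snd) (Computable.const _))
  have h1 : Primrec fun p : List ℕ × ℕ => p.1.findIdx fun a => decide (a < p.2) :=
    Primrec.list_findIdx Primrec.fst (Primrec.nat_lt.decide.comp Primrec.snd
      (Primrec.snd.comp Primrec.fst)).to₂
  have hidx := h1.to_comp.comp (hq.pair hN)
  have hz := primrec_replicate.to_comp.comp hlen (Computable.const (0 : ℕ))
  have hw := dY.computable_sel.comp ((computable_nodeEval dX dY hζ hG).comp Computable.fst
    (hz.pair (Computable.const (dY.leb + 3))))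
  have hc := Primrec.nat_lt.decide.to_comp.comp hidx hlen
  have h2 := Computable.cond hc ((Computable.sumInr (α := Fin E.size)).comp hidx)
    ((Computable.sumInl (β := ℕ)).comp hw)
  refine h2.of_eq fun σ => ?_
  rw [Bool.cond_decide]
  rfl

theorem computable_nodeChild {ζ : ℕ → ℕ} {G : List ℕ → ℕ → ℕ} (hζ : Computable ζ)
    (hG : Computable₂ G) : Computable₂ (nodeChild dX dY ζ G) := by
  have hw : Computable fun p : (State D E × ℕ) × Fin E.size => writeChild p.1.1 p.2 p.1.2 := by
    have hσ : Computable fun p : (State D E × ℕ) × Fin E.size => p.1.1 :=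
      Computable.fst.comp Computable.fst
    have hst : Computable fun p : (State D E × ℕ) × Fin E.size =>
        (Sum.inr (p.2, p.1.2) : Step D E) :=
      Computable.sumInr.comp (Computable.snd.pair (Computable.snd.comp Computable.fst))
    have h := (Computable.list_cons.comp hst (Computable.fst.comp hσ)).pair
      ((Computable.fst.comp (Computable.snd.comp hσ)).pair
        (Computable.succ.comp (Computable.snd.comp (Computable.snd.comp hσ))))
    exact h
  have hr : Computable fun p : (State D E × ℕ) × ℕ =>
      readChild p.1.1 p.2 (toFin (dX.sel 0) p.1.2) := by
    have hσ : Computable fun p : (State D E × ℕ) × ℕ => p.1.1 :=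
      Computable.fst.comp Computable.fst
    have hj : Computable fun p : (State D E × ℕ) × ℕ => p.1.1.2.2 :=
      Computable.snd.comp (Computable.snd.comp hσ)
    have hq : Computable fun p : (State D E × ℕ) × ℕ => p.1.1.2.1 :=
      Computable.fst.comp (Computable.snd.comp hσ)
    have hd : Computable fun p : (State D E × ℕ) × ℕ => toFin (dX.sel 0) p.1.2 :=
      (computable_toFin _).comp (Computable.snd.comp Computable.fst)
    have hst : Computable fun p : (State D E × ℕ) × ℕ =>
        (Sum.inl (p.2, toFin (dX.sel 0) p.1.2, p.1.1.2.2) : Step D E) :=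
      Computable.sumInl.comp (Computable.snd.pair (hd.pair hj))
    have hrep := primrec_replicate.to_comp.comp ((Primrec.dom_finite D.ar).to_comp.comp hd)
      (Computable.succ.comp ((Primrec.list_getD 0).to_comp.comp hq Computable.snd))
    have h := (Computable.list_cons.comp hst (Computable.fst.comp hσ)).pair
      ((primrec_plugList.to_comp.comp (hq.pair (Computable.snd.pair hrep))).pair hj)
    exact h
  have h1 := Computable.sumCasesOn ((computable_nodeLabel dX dY hζ hG).comp Computable.fst)
    hw.to₂ hr.to₂
  refine h1.of_eq fun p => ?_
  change _ = Sum.elim _ _ _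
  cases nodeLabel dX dY ζ G p.1 <;> rfl

/-- A label is found by recursion on the address, the state being the parameter that changes along
the way. -/
theorem isComputable_unfold {ζ : ℕ → ℕ} {G : List ℕ → ℕ → ℕ} (hζ : Computable ζ)
    (hG : Computable₂ G) (σ : State D E) :
    (LTree.unfold (labelAr D E) (nodeLabel dX dY ζ G) (nodeChild dX dY ζ G) σ).IsComputable := by
  have hlab := computable_nodeLabel dX dY hζ hG
  have hch : Computable₂ fun (c : ℕ) (σ : State D E) => nodeChild dX dY ζ G σ c :=
    (computable_nodeChild dX dY hζ hG).comp Computable.snd Computable.fst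
  have har : Computable fun a : Label E => labelAr D E a :=
    (computable_branching (D := D)).comp Computable.option_some
  have hlab' : Computable fun p : (ℕ × State D E) × Option (Label E) =>
      labelAr D E (nodeLabel dX dY ζ G p.1.2) :=
    har.comp (hlab.comp (Computable.snd.comp Computable.fst))
  have hc := Primrec.nat_lt.decide.to_comp.comp (Computable.fst.comp Computable.fst) hlab'
  have hpost := Computable.cond hc Computable.snd (Computable.const none)
  have h := computable_list_rec_param
    (f := LTree.unfoldLabel (labelAr D E) (nodeLabel dX dY ζ G) (nodeChild dX dY ζ G))
    (Computable.option_some.comp hlab) hch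
    (post := fun c σ r => cond (decide (c < labelAr D E (nodeLabel dX dY ζ G σ))) r none)
    hpost (fun _ => rfl) fun c s σ => by rw [Bool.cond_decide]; rfl
  have h' := h.comp (Computable.id (α := List ℕ)) (Computable.const σ)
  exact h'

end Completeness

section Completeness

variable {X : Type*} [MetricSpace X] {Y : Type*} [MetricSpace Y]
  {D : ExtendedIFS X} {E : ExtendedIFS Y}
  {QX : ℕ → X} {QY : ℕ → Y} (dX : EffectiveData D QX) (dY : EffectiveData E QY)
  (ζ : ℕ → ℕ) (G : List ℕ → ℕ → ℕ)

/-! ### Termination of reading -/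

/-- The weight of an argument that has been read `a` times and has to be read `N` times. -/
def readWeight (A N a : ℕ) : ℕ := if a < N then (A + 1) ^ (N - a) else 0

/-- The base `A + 1` exceeds every arity, so the at most `A` successors of an argument together
weigh less than the argument itself. -/
theorem mul_readWeight_succ_lt {A N a n : ℕ} (hn : n ≤ A) (ha : a < N) :
    n * readWeight A N (a + 1) < readWeight A N a := by
  have h0 : 0 < (A + 1) ^ (N - (a + 1)) := by positivity
  have h1 : readWeight A N (a + 1) ≤ (A + 1) ^ (N - (a + 1)) := by
    unfold readWeight
    split_ifs <;> omega
  have h2 : readWeight A N a = (A + 1) ^ (N - (a + 1)) * (A + 1) := by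
    rw [readWeight, if_pos ha, ← pow_succ]
    congr 1
    omega
  rw [h2]
  nlinarith [Nat.mul_le_mul hn h1]

theorem sum_readWeight_plugList_lt {A N n i : ℕ} {q : List ℕ} (hn : n ≤ A) (hi : i < q.length)
    (hlt : q.getD i 0 < N) :
    ((plugList q i (List.replicate n (q.getD i 0 + 1))).map (readWeight A N)).sum <
      (q.map (readWeight A N)).sum := by
  have hq : q = q.take i ++ (q.getD i 0 :: q.drop (i + 1)) := by
    rw [List.getD_eq_getElem _ _ hi, ← List.drop_eq_getElem_cons hi, List.take_append_drop]
  have h2 : (q.map (readWeight A N)).sum = ((q.take i).map (readWeight A N)).sum +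
      (readWeight A N (q.getD i 0) + ((q.drop (i + 1)).map (readWeight A N)).sum) := by
    conv_lhs => rw [hq]
    rw [List.map_append, List.sum_append, List.map_cons, List.sum_cons]
  have h1 := mul_readWeight_succ_lt hn hlt
  rw [h2, plugList]
  simp only [List.map_append, List.sum_append, List.map_replicate, List.sum_replicate,
    smul_eq_mul]
  omega

/-! ### The invariant of the transition system -/

/-- The relation between a state and the map belonging to it: a modulus of continuity that takes
into account how often the arguments have been read, and approximations at basic points. -/
structure StateInv (σ : State D E) (f : Maps X Y) : Prop where
  length_eq : σ.2.1.length = f.1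
  modulus : ∀ k x x', (∀ t : Fin f.1, dX.K ^ σ.2.1.getD t 0 * dist (x t) (x' t) <
    (1 / 2 : ℝ) ^ modAfter dY ζ σ.2.2 k) → dist (f.2 x) (f.2 x') < (1 / 2 : ℝ) ^ k
  approx : ∀ l k, l.length = f.1 →
    dist (f.2 (tuple QX l f.1)) (QY (nodeEval dX dY ζ G σ.1 (l, k))) < (1 / 2 : ℝ) ^ k

/-- The factor will be a power of the contraction constant, which may vanish; this is why division
by it is not enough. -/
theorem mul_dist_pi_lt {n : ℕ} {c r : ℝ} (hc : 0 ≤ c) (hr : 0 < r) {y y' : Fin n → X}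
    (h : ∀ j, c * dist (y j) (y' j) < r) : c * dist y y' < r := by
  rcases hc.eq_or_lt with rfl | hc
  · simpa using hr
  · rw [← lt_div_iff₀' hc, dist_pi_lt_iff (div_pos hr hc)]
    intro j
    rw [lt_div_iff₀' hc]
    exact h j

variable {dX dY ζ G}

/-- For the modulus, the contraction of the digit is paid for by the additional factor `K` of the
new arguments. For the approximation, half of the error comes from replacing the digit's value by a
basic point, controlled by the modulus at `k + 1`, and half from the evaluation at the previous
node. -/
theorem StateInv.readChild {σ : State D E} {f : Maps X Y} (h : StateInv dX dY ζ G σ f)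
    (i : Fin f.1) (d : Fin D.size) :
    StateInv dX dY ζ G (readChild σ i d) ⟨D.ar d + f.1 - 1, f.2 ∘ plug (D.digit d) i⟩ := by
  have hil : (i : ℕ) < σ.2.1.length := by rw [h.length_eq]; exact i.2
  have hn := D.ar_pos d
  have hK0 := dX.K_nonneg
  refine ⟨?_, fun k x x' hx => ?_, fun l k hl => ?_⟩
  · simp only [DigitSpaces.readChild]
    rw [length_plugList hil, List.length_replicate, h.length_eq]
  · simp only [DigitSpaces.readChild, getD_plugList hil, List.length_replicate] at hx
    refine h.modulus k _ _ fun t => ?_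
    rcases lt_trichotomy (t : ℕ) i with h1 | h1 | h1
    · have := hx ⟨t, by omega⟩
      simpa [plug, h1] using this
    · obtain rfl : t = i := Fin.ext h1
      simp only [plug, lt_irrefl, dite_false, dite_true]
      refine lt_of_le_of_lt (mul_le_mul_of_nonneg_left (dX.dist_digit d _ _) (pow_nonneg hK0 _)) ?_
      rw [← mul_assoc, ← pow_succ]
      refine mul_dist_pi_lt (pow_nonneg hK0 _) (half_pow_pos _) fun j => ?_
      have := hx ⟨t + j, by omega⟩
      simpa [List.getD_eq_getElem?_getD] using this
    · have e1 : ¬ (t : ℕ) < i := by omega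
      have e2 : ¬ (t : ℕ) = i := by omega
      have e3 : ¬ (t : ℕ) + D.ar d - 1 < i := by omega
      have e4 : ¬ (t : ℕ) + D.ar d - 1 < i + D.ar d := by omega
      have e5 : (t : ℕ) + D.ar d - 1 + 1 - D.ar d = t := by omega
      have := hx ⟨t + D.ar d - 1, by omega⟩
      simp only [e3, e4, e5, if_false] at this
      simpa only [plug, e1, e2, dite_false] using this
  · dsimp only at hl ⊢
    set v := dX.appr d ((l.drop i).take (D.ar d), modAfter dY ζ σ.2.2 (k + 1)) with hv
    have hlen : ((l.drop i).take (D.ar d)).length = D.ar d := by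
      simp only [List.length_take, List.length_drop]
      omega
    have h1 := h.approx (collapse l i (D.ar d) v) (k + 1) (length_collapse hl hn i.2)
    have h2 : dist (f.2 (plug (D.digit d) i (tuple QX l (D.ar d + f.1 - 1))))
        (f.2 (tuple QX (collapse l i (D.ar d) v) f.1)) < (1 / 2 : ℝ) ^ (k + 1) := by
      refine h.modulus (k + 1) _ _ fun t => ?_
      refine (mul_le_of_le_one_left dist_nonneg (pow_le_one₀ hK0 dX.K_lt_one.le)).trans_lt ?_
      exact dist_plug_collapse_lt hn (D.digit d) i hl (half_pow_pos _)
        (dX.appr_spec d _ _ hlen) t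
    have h3 := half_pow_succ k
    have h4 := dist_triangle (f.2 (plug (D.digit d) i (tuple QX l (D.ar d + f.1 - 1))))
      (f.2 (tuple QX (collapse l i (D.ar d) v) f.1))
      (QY (nodeEval dX dY ζ G σ.1 (collapse l i (D.ar d) v, k + 1)))
    change dist (f.2 (plug (D.digit d) i (tuple QX l (D.ar d + f.1 - 1))))
      (QY (nodeEval dX dY ζ G σ.1 (collapse l i (D.ar d) v, k + 1))) < _
    linarith

/-- All values lie in the Lebesgue ball around `QY v`, where the right inverse of the selected digit
is available with modulus `om`. Each writing node therefore costs one application of `om`. -/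
theorem StateInv.writeChild {σ : State D E} {f : Maps X Y} (h : StateInv dX dY ζ G σ f)
    {v : ℕ} (hv : ∀ x, dist (f.2 x) (QY v) < (1 / 2 : ℝ) ^ (dY.leb + 2))
    (κ : Fin (E.ar (dY.sel v))) :
    StateInv dX dY ζ G (writeChild σ (dY.sel v) κ)
      ⟨f.1, fun x => dY.sec (dY.sel v) (f.2 x) κ⟩ := by
  have hint : ∀ x, f.2 x ∈ interior (Set.range (E.digit (dY.sel v))) := fun x =>
    ball_subset_interior (dY.ball_sel v) (Metric.mem_ball.2 ((hv x).trans_le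
      (half_pow_anti (Nat.le_add_right _ 2))))
  refine ⟨h.length_eq, fun k x x' hx => ?_, fun l k hl => ?_⟩
  · refine (dist_le_pi_dist _ _ κ).trans_lt (dY.dist_sec _ k _ _ (hint x) (hint x') ?_)
    -- `om^[j + 1] k` unfolds to `om^[j] (om k)`, so the moduli agree by definition.
    exact h.modulus (dY.om k) x x' hx
  · dsimp only at hl ⊢
    -- The digit was selected at `v`, but the right inverse is approximated at `w`. Both are close
    -- to the same value, so the half-size ball around `w` stays in the ball around `v`.
    set w := nodeEval dX dY ζ G σ.1 (l, dY.om k) with hw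
    have h1 : dist (f.2 (tuple QX l f.1)) (QY w) < (1 / 2 : ℝ) ^ dY.om k :=
      h.approx l (dY.om k) hl
    have h2 : dist (QY w) (QY v) < (1 / 2 : ℝ) ^ (dY.leb + 1) := by
      have a1 := half_pow_anti (dY.leb_le_om k)
      have a2 := half_pow_succ (dY.leb + 1)
      have a3 := hv (tuple QX l f.1)
      have a4 := dist_triangle_left (QY w) (QY v) (f.2 (tuple QX l f.1))
      linarith
    have h3 : Metric.ball (QY w) ((1 / 2 : ℝ) ^ (dY.leb + 1)) ⊆
        Set.range (E.digit (dY.sel v)) := by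
      refine (Metric.ball_subset_ball' ?_).trans (dY.ball_sel v)
      have := half_pow_succ dY.leb
      linarith
    have h4 := dY.choice_spec (dY.sel v) k w h3 _ (hint (tuple QX l f.1)) h1
    exact (dist_le_pi_dist _ _ κ).trans_lt h4

/-- The depth of reading depends only on the number of writing nodes passed, not on the arity: the
modulus refers to each argument separately, so new arguments do no harm. -/
theorem StateInv.step {σ : State D E} {f : Maps X Y} (h : StateInv dX dY ζ G σ f) :
    (∃ e, nodeLabel dX dY ζ G σ = Sum.inl e ∧ ∃ g : Fin (E.ar e) → (Fin f.1 → X) → Y,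
      (∀ k : Fin (E.ar e), StateInv dX dY ζ G (nodeChild dX dY ζ G σ k) ⟨f.1, g k⟩) ∧
        f.2 = fun x => E.digit e fun k => g k x) ∨
    ∃ i : Fin f.1, nodeLabel dX dY ζ G σ = Sum.inr (i : ℕ) ∧
      σ.2.1.getD i 0 < readDepth dX dY ζ σ.2.2 ∧ ∀ d : Fin D.size,
      nodeChild dX dY ζ G σ d = DigitSpaces.readChild σ i d ∧
      StateInv dX dY ζ G (nodeChild dX dY ζ G σ d)
        ⟨D.ar d + f.1 - 1, f.2 ∘ plug (D.digit d) i⟩ := by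
  by_cases hlt : σ.2.1.findIdx (fun a => decide (a < readDepth dX dY ζ σ.2.2)) < σ.2.1.length
  · right
    have hlab : nodeLabel dX dY ζ G σ =
        Sum.inr (σ.2.1.findIdx fun a => decide (a < readDepth dX dY ζ σ.2.2)) := if_pos hlt
    have hspec : σ.2.1.getD (σ.2.1.findIdx fun a => decide (a < readDepth dX dY ζ σ.2.2)) 0 <
        readDepth dX dY ζ σ.2.2 := by
      rw [List.getD_eq_getElem _ _ hlt]
      simpa using List.findIdx_getElem (w := hlt)
    generalize (σ.2.1.findIdx fun a => decide (a < readDepth dX dY ζ σ.2.2)) = i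
      at hlt hlab hspec
    rw [h.length_eq] at hlt
    have hch : ∀ d : Fin D.size,
        nodeChild dX dY ζ G σ d = DigitSpaces.readChild σ i d := fun d => by
      rw [nodeChild, hlab, Sum.elim_inr, toFin_val]
    refine ⟨⟨i, hlt⟩, hlab, hspec, fun d => ⟨hch d, ?_⟩⟩
    rw [hch]
    exact h.readChild ⟨i, hlt⟩ d
  · left
    set v := nodeEval dX dY ζ G σ.1 (List.replicate σ.2.1.length 0, dY.leb + 3) with hv
    have hlab : nodeLabel dX dY ζ G σ = Sum.inl (dY.sel v) := if_neg hlt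
    have hdepth : ∀ t : Fin f.1, readDepth dX dY ζ σ.2.2 ≤ σ.2.1.getD t 0 := by
      intro t
      have ht : (t : ℕ) < σ.2.1.length := by rw [h.length_eq]; exact t.2
      by_contra hcon
      refine hlt (List.findIdx_lt_length_of_exists ⟨_, List.getElem_mem ht, ?_⟩)
      rw [List.getD_eq_getElem _ _ ht] at hcon
      simpa using hcon
    -- Once every argument has been read often enough, the map varies by less than `2 ^ (-(leb +
    -- 3))`; the approximation error at the reference tuple is bounded by the same number.
    have hvals : ∀ x, dist (f.2 x) (QY v) < (1 / 2 : ℝ) ^ (dY.leb + 2) := by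
      intro x
      have h1 := h.approx (List.replicate σ.2.1.length 0) (dY.leb + 3)
        (by rw [List.length_replicate, h.length_eq])
      have h2 := h.modulus (dY.leb + 3) x (tuple QX (List.replicate σ.2.1.length 0) f.1)
        fun t => lt_of_le_of_lt
          (mul_le_mul_of_nonneg_left (dX.dist_le _ _) (pow_nonneg dX.K_nonneg _))
          (dX.depth_spec _ _ (hdepth t))
      have h3 := dist_triangle (f.2 x) (f.2 (tuple QX (List.replicate σ.2.1.length 0) f.1)) (QY v)
      have h4 := half_pow_succ (dY.leb + 2)
      linarith
    refine ⟨dY.sel v, hlab, fun k x => dY.sec (dY.sel v) (f.2 x) k, fun k => ?_, ?_⟩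
    · rw [nodeChild, hlab, Sum.elim_inl]
      exact h.writeChild hvals k
    · funext x
      refine (dY.digit_sec _ _ (ball_subset_interior (dY.ball_sel v) (Metric.mem_ball.2 ?_))).symm
      exact (hvals x).trans_le (half_pow_anti (Nat.le_add_right _ 2))

/-- A computable map is realised by a computable tree. -/
theorem exists_computable_realiser (dX : EffectiveData D QX) (dY : EffectiveData E QY)
    {f : Maps X Y} (hf : IsComputableMap QX QY f.2) :
    ∃ T : FTree D E, T.IsComputable ∧ Realises D E T f := by
  obtain ⟨⟨ζ, hζ, hζ'⟩, G, hG, hG'⟩ := isComputableMap_iff.1 hf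
  let σ₀ : State D E := ([], List.replicate f.1 0, 0)
  have hstart : StateInv dX dY ζ G σ₀ f := by
    refine ⟨by simp [σ₀], fun k x x' hx => hζ' k x x' ?_, fun l k hl => hG' l k hl⟩
    rw [dist_pi_lt_iff (half_pow_pos _)]
    intro t
    simpa [σ₀, modAfter, List.getD_eq_getElem?_getD] using hx t
  -- The largest arity bounds the number of arguments that can replace a single one.
  let A := Finset.univ.sup D.ar
  refine ⟨_, isComputable_unfold dX dY hζ hG σ₀, realises_unfold (I := StateInv dX dY ζ G)
    (rk := fun σ => (σ.2.1.map (readWeight A (readDepth dX dY ζ σ.2.2))).sum) ?_ hstart⟩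
  intro σ f h
  rcases h.step with hw | ⟨i, hi, hlt, hd⟩
  · exact Or.inl hw
  · refine Or.inr ⟨i, hi, fun d => ⟨?_, (hd d).2⟩⟩
    rw [(hd d).1]
    exact sum_readWeight_plugList_lt (Finset.le_sup (Finset.mem_univ d))
      (by rw [h.length_eq]; exact i.2) hlt

end Completeness

end DigitSpaces

theorem mainTheorem5 {X Y : Type*} [MetricSpace X] [MetricSpace Y]
    (D : DigitSpaces.ExtendedIFS X) (QX : ℕ → X)
    (E : DigitSpaces.ExtendedIFS Y) (QY : ℕ → Y)
    (hX : DigitSpaces.IsComputableDigitSpace D QX)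
    (hXdec : DigitSpaces.IsDecidable D QX)
    (hXwc : DigitSpaces.IsWellCovering D)
    (hXac : DigitSpaces.HasApproximableChoice D QX)
    (hY : DigitSpaces.IsComputableDigitSpace E QY)
    (hYdec : DigitSpaces.IsDecidable E QY)
    (hYwc : DigitSpaces.IsWellCovering E)
    (hYac : DigitSpaces.HasApproximableChoice E QY) :
    DigitSpaces.CF D E = {f | ∃ T : DigitSpaces.FTree D E, DigitSpaces.Realises D E T f} ∧
    {f : DigitSpaces.Maps X Y |
        ∃ T : DigitSpaces.FTree D E, T.IsComputable ∧ DigitSpaces.Realises D E T f} =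
      {f : DigitSpaces.Maps X Y | DigitSpaces.IsComputableMap QX QY f.2} := by
  obtain ⟨dX⟩ := DigitSpaces.nonempty_effectiveData hX hXdec hXwc hXac
  obtain ⟨dY⟩ := DigitSpaces.nonempty_effectiveData hY hYdec hYwc hYac
  refine ⟨Set.ext fun f => ⟨DigitSpaces.exists_realises_of_mem_CF, ?_⟩, Set.ext fun f => ⟨?_, ?_⟩⟩
  · rintro ⟨T, hT⟩
    exact DigitSpaces.mem_CF_of_realises hT
  · rintro ⟨T, hT, h⟩
    exact DigitSpaces.isComputableMap_of_realises dX dY hT h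
  · exact fun hf => DigitSpaces.exists_computable_realiser dX dY hf
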